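/- Let $\mathcal H$ be a separable complex Hilbert space. A state is a positive operator on $\mathcal H$ with unit trace, and $S(\rho)=\operatorname{Tr}\eta(\rho)\in[0,+\infty]$, $\eta(x)=-x\ln x$, $\eta(0)=0$, is the von Neumann entropy. Let $H$ be a positive self-adjoint operator with infinite-dimensional domain $\mathcal D(H)$ (if $\mathcal D(H)$ is not dense, $H$ is self-adjoint in $\mathrm{cl}(\mathcal D(H))$ and regarded as $+\infty$ on $\mathcal D(H)^\perp$), such that $$\operatorname{Tr}e^{-\beta H}<+\infty\ \text{ for all }\beta>0\qquad\text{and}\qquad \inf_{\varphi\in\mathcal D(H),\,\|\varphi\|=1}\langle\varphi|H|\varphi\rangle=0 .$$ For a positive trace-class operator $\rho$ put $\operatorname{Tr}H\rho=\sup_n\operatorname{Tr}P_nH\rho$ if $\operatorname{supp}\rho\subseteq\mathrm{cl}(\mathcal D(H))$, where $P_n$ is the spectral projector of $H$ for $[0,n]$, and $\operatorname{Tr}H\rho=+\infty$ otherwise. Let $F_H(E)=\sup\{S(\rho)\,|\,\rho\text{ a state},\ \operatorname{Tr}H\rho\le E\}$ and $g(x)=(x+1)\ln(x+1)-x\ln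 x$. (1) Let $\varepsilon>0$, $E\ge 0$ and let $\rho$ be a state with $\operatorname{Tr}H\rho\le E$. Put $E_{H,\varepsilon}(\rho)=\operatorname{Tr}H[\rho-\varepsilon I]_+$, where $[\,\cdot\,]_+$ is the positive part. Then $S(\rho)$ and $F_H(E/\varepsilon)$ are finite, $E_{H,\varepsilon}(\rho)\le E$, and $$S(\rho)-S(\sigma)\le\varepsilon F_H\big((E-E_{H,\varepsilon}(\rho))/\varepsilon\big)+g(\varepsilon)\le\varepsilon F_H(E/\varepsilon)+g(\varepsilon)$$ for every state $\sigma$ such that $\frac12\|\rho-\sigma\|_1\le\varepsilon$ (the left-hand side may be $-\infty$). (2) The eigenvalues of $\rho$, arranged in non-increasing order with multiplicity, form a sequence $\{\lambda_k^\rho\}_{k\ge0}$, and those of $H$, arranged in non-decreasing order with multiplicity, form a sequence $\{E_k^H\}_{k\ge0}$. In (1), the quantity $E_{H,\varepsilon}(\rho)$ can be replaced in both inequalities by its lower bound $$E^*_{H,\varepsilon}(\rho)=\sum_{k=0}^{+\infty}E_k^H[\lambda_k^\rho-\varepsilon]_+\le E_{H,\varepsilon}(\rho),\qquad [x]_+=\max\{x,0\}.$$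 (3) For every $E>0$ and $\varepsilon\in(0,1]$ there exist states $\rho$ and $\sigma$ such that $$S(\rho)-S(\sigma)\ge\varepsilon F_H(E/\varepsilon),\qquad\operatorname{Tr}H\rho\le E,\qquad\tfrac12\|\rho-\sigma\|_1\le\varepsilon,$$ and if $\varepsilon<1$ they can be chosen so that the first inequality is strict. -/

import Mathlib

open scoped NNReal ENNReal

noncomputable section

/-! ### Trace, states, entropy -/

section States

variable {𝓗 : Type*} [NormedAddCommGroup 𝓗] [InnerProductSpace ℂ 𝓗] [CompleteSpace 𝓗]

/-- The trace `∑ᵢ ⟪bᵢ, A bᵢ⟫ ∈ [0, ∞]` of a positive bounded operator `A`, computed in an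
orthonormal basis `b` of `𝓗` (for positive `A` it does not depend on the basis). -/
def posTrace (A : 𝓗 →L[ℂ] 𝓗) : ℝ≥0∞ :=
  ∑' b : (exists_hilbertBasis ℂ 𝓗).choose,
    ENNReal.ofReal (inner ℂ (b : 𝓗) (A (b : 𝓗))).re

/-- The trace norm `‖T‖₁ = Tr |T|`, with `|T| = (T* T)^{1/2}`; it is `∞` iff `T` is not
trace-class. -/
def traceNorm (T : 𝓗 →L[ℂ] 𝓗) : ℝ≥0∞ :=
  posTrace (CFC.abs T)

/-- A quantum state: a positive operator of unit trace. -/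
structure IsState (ρ : 𝓗 →L[ℂ] 𝓗) : Prop where
  isPositive : ρ.IsPositive
  trace_eq_one : posTrace ρ = 1

/-- The von Neumann entropy `S(ρ) = Tr η(ρ) ∈ [0, ∞]`, where `η(x) = -x ln x`, `η(0) = 0`. -/
def vonNeumannEntropy (ρ : 𝓗 →L[ℂ] 𝓗) : ℝ≥0∞ :=
  posTrace (cfc Real.negMulLog ρ)

/-- The positive part `[ρ - ε I]₊` of the Hermitian operator `ρ - ε I`. -/
def cutOff (ρ : 𝓗 →L[ℂ] 𝓗) (ε : ℝ) : 𝓗 →L[ℂ] 𝓗 :=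
  (ρ - (ε : ℂ) • ContinuousLinearMap.id ℂ 𝓗)⁺

/-- `lam` is the nonincreasing sequence of eigenvalues (with multiplicity) of `ρ`:
`ρ = ∑ₖ lamₖ |φₖ⟩⟨φₖ|` (strongly) for some orthonormal system `φ`. -/
def IsDecreasingEigenvalueSeq (ρ : 𝓗 →L[ℂ] 𝓗) (lam : ℕ → ℝ) : Prop :=
  Antitone lam ∧ ∃ φ : ℕ → 𝓗, Orthonormal ℂ φ ∧
    ∀ x : 𝓗, HasSum (fun k => ((lam k : ℂ) * inner ℂ (φ k) x) • φ k) (ρ x)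

end States

/-! ### Positive (unbounded) operators -/

/-- A positive operator on `𝓗`: a positive self-adjoint operator acting in the closed subspace
`cl D(H)`. When the domain is dense this is exactly a positive self-adjoint operator on `𝓗`.
A domain that is not dense is allowed, and the operator is then regarded as equal to `+∞`
on the orthogonal complement of the domain. -/
structure PositiveOperator (𝓗 : Type*) [NormedAddCommGroup 𝓗] [InnerProductSpace ℂ 𝓗] where
  /-- the underlying partially defined linear operator -/
  op : 𝓗 →ₗ.[ℂ] 𝓗
  /-- it acts in the closure of its domain -/
  map_mem : ∀ x : op.domain, op x ∈ op.domain.topologicalClosure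
  /-- it is symmetric -/
  symmetric : ∀ x y : op.domain, inner ℂ (op x) (y : 𝓗) = inner ℂ (x : 𝓗) (op y)
  /-- it is positive -/
  nonneg : ∀ x : op.domain, 0 ≤ (inner ℂ (x : 𝓗) (op x)).re
  /-- the domain of the adjoint (in the closure of the domain) is not larger than the domain -/
  maximal : ∀ ψ ∈ op.domain.topologicalClosure, ∀ η ∈ op.domain.topologicalClosure,
    (∀ x : op.domain, inner ℂ η (x : 𝓗) = inner ℂ ψ (op x)) → ψ ∈ op.domain

namespace PositiveOperator

variable {𝓗 : Type*} [NormedAddCommGroup 𝓗] [InnerProductSpace ℂ 𝓗]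

/-- `R` is the resolvent `(I + H)⁻¹` on `cl D(H)`, extended by zero to the orthogonal complement:
for every `ψ` the vector `x = R ψ` lies in `D(H)` and `x + H x` is the orthogonal projection
of `ψ` onto `cl D(H)`. -/
def IsResolvent (H : PositiveOperator 𝓗) (R : 𝓗 →L[ℂ] 𝓗) : Prop :=
  ∀ ψ : 𝓗, ∃ h : R ψ ∈ H.op.domain,
    ∀ y ∈ H.op.domain, inner ℂ y (ψ - (R ψ + H.op ⟨R ψ, h⟩)) = 0

/-- `H` satisfies `E₀ = inf_{‖φ‖ = 1} ⟨φ|H|φ⟩ = 0`. -/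
def ZeroGroundEnergy (H : PositiveOperator 𝓗) : Prop :=
  IsGLB {e : ℝ | ∃ φ : H.op.domain, ‖(φ : 𝓗)‖ = 1 ∧ e = (inner ℂ (φ : 𝓗) (H.op φ)).re} 0

/-- `en` is the nondecreasing sequence of eigenvalues (with multiplicity) of `H`, where `H` has
pure point spectrum: `H = ∑ₖ enₖ |τₖ⟩⟨τₖ|` for an orthonormal system `τ` of eigenvectors of `H`
whose closed linear span contains the domain of `H`. -/
def IsIncreasingEigenvalueSeq (H : PositiveOperator 𝓗) (en : ℕ → ℝ) : Prop :=
  Monotone en ∧ ∃ τ : ℕ → 𝓗, Orthonormal ℂ τ ∧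
    (∀ k, ∃ h : τ k ∈ H.op.domain, H.op ⟨τ k, h⟩ = (en k : ℂ) • τ k) ∧
    H.op.domain ≤ (Submodule.span ℂ (Set.range τ)).topologicalClosure

/-! The resolvent of a positive operator exists. -/

theorem norm_le_norm_add (H : PositiveOperator 𝓗) (x : H.op.domain) :
    ‖(x : 𝓗)‖ ≤ ‖(x : 𝓗) + H.op x‖ := by
  have h1 : ‖(x : 𝓗)‖ * ‖(x : 𝓗)‖ ≤ ‖(x : 𝓗)‖ * ‖(x : 𝓗) + H.op x‖ := by
    calc ‖(x : 𝓗)‖ * ‖(x : 𝓗)‖ ≤ (inner ℂ (x : 𝓗) ((x : 𝓗) + H.op x)).re := by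
          rw [inner_add_right, Complex.add_re, inner_self_eq_norm_sq_to_K]
          have := H.nonneg x
          have h2 : (((‖(x : 𝓗)‖ : ℂ)) ^ 2).re = ‖(x : 𝓗)‖ * ‖(x : 𝓗)‖ := by
            rw [← Complex.ofReal_pow, Complex.ofReal_re, sq]
          simp only [Complex.coe_algebraMap]
          linarith
      _ ≤ ‖inner ℂ (x : 𝓗) ((x : 𝓗) + H.op x)‖ := Complex.re_le_norm _
      _ ≤ _ := norm_inner_le_norm _ _
  rcases (norm_nonneg (x : 𝓗)).eq_or_lt with h | h
  · rw [← h]; exact norm_nonneg _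
  · exact le_of_mul_le_mul_left h1 h

theorem eq_zero_of_inner_eq_zero (H : PositiveOperator 𝓗) {w : 𝓗}
    (hw : w ∈ H.op.domain.topologicalClosure)
    (h : ∀ y : H.op.domain, inner ℂ (y : 𝓗) w = 0) : w = 0 := by
  have h1 : H.op.domain.topologicalClosure ≤ (Submodule.span ℂ {w})ᗮ := by
    refine Submodule.topologicalClosure_minimal _ ?_ (Submodule.isClosed_orthogonal _)
    intro y hy
    rw [Submodule.mem_orthogonal_singleton_iff_inner_left]
    exact h ⟨y, hy⟩
  have h2 := Submodule.mem_orthogonal_singleton_iff_inner_left.1 (h1 hw)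
  exact inner_self_eq_zero.1 h2

/-- The map `x ↦ x + H x` on `D(H)`. -/
def addId (H : PositiveOperator 𝓗) : H.op.domain →ₗ[ℂ] 𝓗 :=
  H.op.domain.subtype + H.op.toFun

theorem addId_apply (H : PositiveOperator 𝓗) (x : H.op.domain) :
    H.addId x = (x : 𝓗) + H.op x := rfl

theorem isClosed_range_addId [CompleteSpace 𝓗] (H : PositiveOperator 𝓗) :
    IsClosed (LinearMap.range H.addId : Set 𝓗) := by
  refine isClosed_of_closure_subset fun y hy => ?_
  obtain ⟨u, hu, hlim⟩ := mem_closure_iff_seq_limit.1 hy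
  choose x hx using hu
  have hc : CauchySeq (fun n => ((x n : H.op.domain) : 𝓗)) := by
    rw [Metric.cauchySeq_iff]
    intro δ hδ
    obtain ⟨N, hN⟩ := Metric.cauchySeq_iff.1 hlim.cauchySeq δ hδ
    refine ⟨N, fun m hm n hn => lt_of_le_of_lt ?_ (hN m hm n hn)⟩
    have := H.norm_le_norm_add (x m - x n)
    rw [← H.addId_apply, map_sub, hx, hx] at this
    simpa [dist_eq_norm] using this
  obtain ⟨z, hz⟩ := cauchySeq_tendsto_of_complete hc
  have hzK : z ∈ H.op.domain.topologicalClosure :=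
    H.op.domain.isClosed_topologicalClosure.mem_of_tendsto hz
      (Filter.Eventually.of_forall fun n => H.op.domain.le_topologicalClosure (x n).2)
  have hH : Filter.Tendsto (fun n => H.op (x n)) Filter.atTop (nhds (y - z)) := by
    have := hlim.sub hz
    refine this.congr fun n => ?_
    rw [← hx n, H.addId_apply, add_sub_cancel_left]
  have hyzK : y - z ∈ H.op.domain.topologicalClosure :=
    H.op.domain.isClosed_topologicalClosure.mem_of_tendsto hH
      (Filter.Eventually.of_forall fun n => H.map_mem (x n))
  have key : ∀ w : H.op.domain, inner ℂ (y - z) (w : 𝓗) = inner ℂ z (H.op w) := by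
    intro w
    have h1 := hH.inner (𝕜 := ℂ) (tendsto_const_nhds (x := (w : 𝓗)))
    have h2 := hz.inner (𝕜 := ℂ) (tendsto_const_nhds (x := H.op w))
    refine tendsto_nhds_unique (h1.congr fun n => ?_) h2
    exact H.symmetric (x n) w
  have hzD := H.maximal z hzK (y - z) hyzK key
  refine ⟨⟨z, hzD⟩, ?_⟩
  have h3 : (y - z) - H.op ⟨z, hzD⟩ = 0 := by
    refine H.eq_zero_of_inner_eq_zero (Submodule.sub_mem _ hyzK (H.map_mem _)) fun w => ?_
    rw [← inner_conj_symm, inner_sub_left, key w, H.symmetric ⟨z, hzD⟩ w, sub_self, map_zero]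
  rw [H.addId_apply, ← sub_eq_zero.1 h3]
  simp

theorem range_addId [CompleteSpace 𝓗] (H : PositiveOperator 𝓗) :
    LinearMap.range H.addId = H.op.domain.topologicalClosure := by
  have hle : LinearMap.range H.addId ≤ H.op.domain.topologicalClosure := by
    rintro _ ⟨x, rfl⟩
    exact Submodule.add_mem _ (H.op.domain.le_topologicalClosure x.2) (H.map_mem x)
  refine le_antisymm hle fun y hy => ?_
  have : CompleteSpace (LinearMap.range H.addId) :=
    H.isClosed_range_addId.completeSpace_coe
  set p : 𝓗 := (LinearMap.range H.addId).starProjection y with hp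
  have hpM : p ∈ LinearMap.range H.addId := Submodule.starProjection_apply_mem _ _
  have hη : y - p ∈ (LinearMap.range H.addId)ᗮ := Submodule.sub_starProjection_mem_orthogonal y
  have hηK : y - p ∈ H.op.domain.topologicalClosure := Submodule.sub_mem _ hy (hle hpM)
  have h0 : ∀ x : H.op.domain, inner ℂ (y - p) ((x : 𝓗) + H.op x) = 0 := fun x =>
    Submodule.inner_left_of_mem_orthogonal (LinearMap.mem_range_self H.addId x) hη
  have hD : y - p ∈ H.op.domain := by
    refine H.maximal _ hηK (-(y - p)) (Submodule.neg_mem _ hηK) fun x => ?_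
    have := h0 x
    rw [inner_add_right] at this
    rw [inner_neg_left]
    linear_combination -this
  have h4 : inner ℂ (y - p) (y - p) = 0 := by
    have h5 := h0 ⟨y - p, hD⟩
    have h6 := H.nonneg ⟨y - p, hD⟩
    rw [inner_add_right] at h5
    have h7 := congrArg Complex.re h5
    rw [Complex.add_re] at h7
    have h8 : 0 ≤ (inner ℂ (y - p) (y - p)).re := inner_self_nonneg (𝕜 := ℂ)
    have h9 : (inner ℂ (y - p) (y - p)).re = 0 := by
      simp only [Complex.zero_re] at h7
      linarith
    have h10 : ‖y - p‖ ^ 2 = 0 := by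
      rw [← h9]; exact (inner_self_eq_norm_sq (𝕜 := ℂ) (y - p)).symm
    rw [norm_eq_zero.1 (pow_eq_zero_iff two_ne_zero |>.1 h10), inner_zero_left]
  rw [sub_eq_zero.1 (inner_self_eq_zero.1 h4)]
  exact hpM

/-- The resolvent exists (and it is clearly unique). -/
theorem exists_isResolvent [CompleteSpace 𝓗] (H : PositiveOperator 𝓗) :
    ∃ R : 𝓗 →L[ℂ] 𝓗, H.IsResolvent R := by
  have hinj : Function.Injective H.addId := by
    rw [← LinearMap.ker_eq_bot, LinearMap.ker_eq_bot']
    intro x hx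
    have := H.norm_le_norm_add x
    rw [← H.addId_apply, hx, norm_zero] at this
    exact Subtype.ext (norm_le_zero_iff.1 this)
  set K := H.op.domain.topologicalClosure with hK
  have : CompleteSpace K := H.op.domain.isClosed_topologicalClosure.completeSpace_coe
  have hmem : ∀ ψ : 𝓗, K.starProjection ψ ∈ LinearMap.range H.addId := fun ψ => by
    rw [H.range_addId]; exact Submodule.starProjection_apply_mem _ _
  choose f hf using hmem
  let L : 𝓗 →ₗ[ℂ] 𝓗 :=
    { toFun := fun ψ => (f ψ : 𝓗)
      map_add' := fun a b => by
        have : f (a + b) = f a + f b := hinj (by rw [map_add, hf, hf, hf, map_add])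
        rw [this]; rfl
      map_smul' := fun c a => by
        have : f (c • a) = c • f a := hinj (by rw [map_smul, hf, hf, map_smul])
        rw [this]; rfl }
  refine ⟨L.mkContinuous 1 fun ψ => ?_, fun ψ => ⟨(f ψ).2, fun y hy => ?_⟩⟩
  · have h1 := H.norm_le_norm_add (f ψ)
    rw [← H.addId_apply, hf] at h1
    rw [one_mul]
    exact h1.trans (Submodule.norm_starProjection_apply_le _ _)
  · have h2 : (f ψ : 𝓗) + H.op (f ψ) = K.starProjection ψ := by rw [← H.addId_apply, hf]
    change inner ℂ y (ψ - ((f ψ : 𝓗) + H.op (f ψ))) = 0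
    rw [h2]
    exact Submodule.inner_right_of_mem_orthogonal (H.op.domain.le_topologicalClosure hy)
      (Submodule.sub_starProjection_mem_orthogonal ψ)

variable [CompleteSpace 𝓗]

/-- The bounded positive operator `(I + H)⁻¹` (zero on the orthogonal complement of `D(H)`). -/
def resolvent (H : PositiveOperator 𝓗) : 𝓗 →L[ℂ] 𝓗 :=
  H.exists_isResolvent.choose

/-- The operator `e^{-β H}`, `β > 0`, as a continuous function of `R = (I + H)⁻¹`: the value
`r = 1 / (1 + t)` of `R` corresponds to the value `t = 1 / r - 1` of `H`, and `r = 0` to `t = ∞`,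
where `e^{-β t} = 0`. -/
def gibbsExp (H : PositiveOperator 𝓗) (β : ℝ) : 𝓗 →L[ℂ] 𝓗 :=
  cfc (fun r : ℝ => if r ≤ 0 then 0 else Real.exp (-β * (1 / r - 1))) H.resolvent

/-- The bounded operator `min(H, n)` (equal to `n` on the orthogonal complement of `D(H)`),
as a continuous function of `R = (I + H)⁻¹`. -/
def truncation (H : PositiveOperator 𝓗) (n : ℕ) : 𝓗 →L[ℂ] 𝓗 :=
  cfc (fun r : ℝ => if r ≤ 0 then (n : ℝ) else min (1 / r - 1) n) H.resolvent

/-- The Gibbs condition: `Tr e^{-β H} < ∞` for all `β > 0`. -/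
def GibbsCondition (H : PositiveOperator 𝓗) : Prop :=
  ∀ β : ℝ, 0 < β → posTrace (H.gibbsExp β) < ∞

/-- The quantity `Tr Hρ ∈ [0, ∞]` for a positive operator `ρ`: the supremum over `n` of
`Tr min(H, n) ρ = Tr ρ^{1/2} min(H, n) ρ^{1/2}`. By monotone convergence this is
`sup_n Tr Pₙ H ρ`, with `Pₙ` the spectral projector of `H` for `[0, n]`, if the support of `ρ`
lies in `cl D(H)`; it is `+∞` otherwise. -/
def energy (H : PositiveOperator 𝓗) (ρ : 𝓗 →L[ℂ] 𝓗) : ℝ≥0∞ :=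
  ⨆ n : ℕ, posTrace (CFC.sqrt ρ * H.truncation n * CFC.sqrt ρ)

/-- `F_H(E) = sup {S(ρ) | ρ a state with Tr Hρ ≤ E}`. -/
def maxEntropy (H : PositiveOperator 𝓗) (E : ℝ≥0∞) : ℝ≥0∞ :=
  ⨆ ρ : {ρ : 𝓗 →L[ℂ] 𝓗 // IsState ρ ∧ H.energy ρ ≤ E}, vonNeumannEntropy ρ.1

end PositiveOperator

/-- `g(x) = (x + 1) ln (x + 1) - x ln x`. -/
def gFun (x : ℝ) : ℝ :=
  (x + 1) * Real.log (x + 1) - x * Real.log x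

/-- `E*_{H,ε}(ρ) = ∑ₖ Eₖ [λₖ - ε]₊`, as a function of the sequences `Eₖ ≥ 0` and `λₖ`. -/
def lowerCutOffEnergy (en lam : ℕ → ℝ) (ε : ℝ) : ℝ≥0∞ :=
  ∑' k, ENNReal.ofReal (en k * max (lam k - ε) 0)

end

noncomputable section

universe u

/-! ### Operators diagonal in a Hilbert basis and their functional calculus -/

section DiagonalOperators

variable {𝓗 : Type*} [NormedAddCommGroup 𝓗] [InnerProductSpace ℂ 𝓗]

/-! By Mirsky's inequality the decreasing eigenvalues λ of ρ and μ of σ satisfy ∑ |λₖ - μₖ| ≤ ‖ρ -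
σ‖₁, so the question becomes one about two sequences. The parts d = (λ - μ)₊ and e = (μ - λ)₊ have
the same sum δ ≤ ε, because both traces are 1, and λ + e = μ + d. Concavity and subadditivity of η
give, term by term, η(λ) ≤ η(μ) + η(d) + (λ + e) ln(1 + δ) (`negMulLog_le_of_add_eq_add`). Summation
yields S(ρ) ≤ S(σ) + δ S(τ) + g(δ), where τ has eigenvalues d/δ in the eigenbasis of ρ.

The energy enters only through τ. Since d ≤ λ and d ≤ ε, the operator δτ + [ρ - εI]₊ is dominated by
ρ, whence Tr Hτ ≤ (E - E_{H,ε}(ρ))/δ. Mixing with the ground state costs no energy, because the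
lowest eigenvalue of H is 0, so δ F_H(X/δ) ≤ ε F_H(X/ε) for δ ≤ ε (`mul_entropy_le_mul_maxEntropy`);
moreover g is increasing (`gFun_mono`).

The Gibbs condition makes the resolvent compact, so H has a basis of eigenvectors. In it the energy
is a weighted sum of diagonal entries (`energy_eq`), and passing to the diagonal does not lower the
entropy (`vonNeumannEntropy_le_diagonal`). Thus F_H is a classical maximum over distributions on the
levels, finite and attained at a Gibbs distribution (`exists_maximizer`).

The quantity E* comes from a rearrangement inequality, Ky Fan's bound followed by Abel summation
(`tsum_mul_eigenvalue_le_energy`), together with monotonicity of F_H. For near-optimality, σ is the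
ground state and ρ the mixture of σ with the Gibbs state of energy E/ε, taken with weight ε. -/

theorem HilbertBasis.hasSum_sq_norm_inner {ι : Type*} (b : HilbertBasis ι ℂ 𝓗) (x : 𝓗) :
    HasSum (fun i => ‖inner ℂ (b i) x‖ ^ 2) (‖x‖ ^ 2) := by
  have h := b.hasSum_inner_mul_inner x x
  have h2 := Complex.hasSum_re h
  convert! h2 using 1
  · ext i
    rw [← inner_conj_symm x (b i), ← Complex.normSq_eq_conj_mul_self, Complex.ofReal_re,
      Complex.normSq_eq_norm_sq]
  · exact (inner_self_eq_norm_sq (𝕜 := ℂ) x).symm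

theorem HilbertBasis.tsum_ofReal_sq_norm_inner {ι : Type*} (b : HilbertBasis ι ℂ 𝓗) (x : 𝓗) :
    ∑' i, ENNReal.ofReal (‖inner ℂ (b i) x‖ ^ 2) = ENNReal.ofReal (‖x‖ ^ 2) := by
  rw [← (b.hasSum_sq_norm_inner x).tsum_eq,
    ENNReal.ofReal_tsum_of_nonneg (fun _ => by positivity) (b.hasSum_sq_norm_inner x).summable]

/-- An orthonormal sequence extends to a Hilbert basis. -/
theorem Orthonormal.exists_hilbertBasis_sum [CompleteSpace 𝓗] {τ : ℕ → 𝓗}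
    (hτ : Orthonormal ℂ τ) :
    ∃ (κ : Set 𝓗) (b : HilbertBasis (ℕ ⊕ κ) ℂ 𝓗), ∀ k, b (Sum.inl k) = τ k := by
  obtain ⟨w, b, hw, hb⟩ := hτ.toSubtypeRange.exists_hilbertBasis_extension
  have hbo : Orthonormal ℂ ((↑) : w → 𝓗) := hb ▸ b.orthonormal
  let κ : Set 𝓗 := w \ Set.range τ
  let e : ℕ ⊕ κ → w := Sum.elim (fun k => ⟨τ k, hw ⟨k, rfl⟩⟩) (fun x => ⟨x, x.2.1⟩)
  have hinj : Function.Injective e := by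
    rintro (i | i) (j | j) h
    · exact congrArg _ (hτ.linearIndependent.injective (congrArg Subtype.val h))
    · exact absurd ⟨i, congrArg Subtype.val h⟩ j.2.2
    · exact absurd ⟨j, (congrArg Subtype.val h).symm⟩ i.2.2
    · have : (i : 𝓗) = j := congrArg (fun x : w => (x : 𝓗)) h
      exact congrArg _ (Subtype.ext this)
  have hsurj : Function.Surjective e := by
    intro x
    by_cases h : (x : 𝓗) ∈ Set.range τ
    · obtain ⟨k, hk⟩ := h
      exact ⟨Sum.inl k, Subtype.ext hk⟩
    · exact ⟨Sum.inr ⟨x, x.2, h⟩, rfl⟩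
  have ho : Orthonormal ℂ (fun i => (e i : 𝓗)) := hbo.comp e hinj
  refine ⟨κ, HilbertBasis.mk ho ?_, fun k => by rw [HilbertBasis.coe_mk]; rfl⟩
  have : Set.range (fun i => (e i : 𝓗)) = Set.range b := by
    rw [hb]
    exact hsurj.range_comp (Subtype.val)
  rw [this, b.dense_span]

/-- The bounded operator `A` is diagonal in the basis `b`, with eigenvalues `a`. -/
def IsDiagonal {ι : Type*} (b : HilbertBasis ι ℂ 𝓗) (a : ι → ℝ) (A : 𝓗 →L[ℂ] 𝓗) : Prop :=
  ∀ i, A (b i) = (a i : ℂ) • b i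

namespace IsDiagonal

variable {ι : Type*} {b : HilbertBasis ι ℂ 𝓗} {a a' : ι → ℝ} {A B : 𝓗 →L[ℂ] 𝓗}

theorem hasSum_apply (h : IsDiagonal b a A) (x : 𝓗) :
    HasSum (fun i => ((a i : ℂ) * inner ℂ (b i) x) • b i) (A x) := by
  have := (b.hasSum_repr x).mapL A
  convert! this using 2 with i
  rw [map_smul, h i, smul_smul, b.repr_apply_apply, mul_comm]

theorem hasSum_inner (h : IsDiagonal b a A) (x : 𝓗) :
    HasSum (fun i => ((a i * ‖inner ℂ (b i) x‖ ^ 2 : ℝ) : ℂ)) (inner ℂ x (A x)) := by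
  have := (h.hasSum_apply x).mapL (innerSL ℂ x)
  rw [innerSL_apply_apply] at this
  convert! this using 2 with i
  rw [innerSL_apply_apply, inner_smul_right, ← inner_conj_symm x (b i), mul_assoc,
    Complex.mul_conj, Complex.normSq_eq_norm_sq]
  push_cast; rfl

theorem hasSum_re_inner (h : IsDiagonal b a A) (x : 𝓗) :
    HasSum (fun i => a i * ‖inner ℂ (b i) x‖ ^ 2) (inner ℂ x (A x)).re := by
  have := Complex.hasSum_re (h.hasSum_inner x)
  simpa only [Complex.ofReal_re] using this

theorem inner_eq_re (h : IsDiagonal b a A) (x : 𝓗) :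
    inner ℂ x (A x) = ((inner ℂ x (A x)).re : ℂ) :=
  (h.hasSum_inner x).unique (Complex.hasSum_ofReal.2 (h.hasSum_re_inner x))

theorem re_inner_basis (h : IsDiagonal b a A) (i : ι) : (inner ℂ (b i) (A (b i))).re = a i := by
  rw [h i, inner_smul_right, inner_self_eq_norm_sq_to_K, b.orthonormal.1 i]
  simp

theorem add (h : IsDiagonal b a A) (h' : IsDiagonal b a' B) :
    IsDiagonal b (fun i => a i + a' i) (A + B) := fun i => by
  simp [h i, h' i, add_smul]

theorem sub (h : IsDiagonal b a A) (h' : IsDiagonal b a' B) :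
    IsDiagonal b (fun i => a i - a' i) (A - B) := fun i => by
  simp [h i, h' i, sub_smul]

variable [CompleteSpace 𝓗]

theorem isSelfAdjoint (h : IsDiagonal b a A) : IsSelfAdjoint A := by
  rw [ContinuousLinearMap.isSelfAdjoint_iff_isSymmetric,
    LinearMap.isSymmetric_iff_inner_map_self_real]
  intro x
  have := h.inner_eq_re x
  rw [ContinuousLinearMap.coe_coe, ← inner_conj_symm, this, Complex.conj_ofReal,
    Complex.conj_ofReal]

theorem isPositive (h : IsDiagonal b a A) (ha : ∀ i, 0 ≤ a i) : A.IsPositive := by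
  rw [ContinuousLinearMap.isPositive_iff']
  refine ⟨h.isSelfAdjoint, fun x => ?_⟩
  rw [← inner_conj_symm, h.inner_eq_re x, Complex.conj_ofReal, Complex.zero_le_real]
  exact (h.hasSum_re_inner x).nonneg fun i => mul_nonneg (ha i) (by positivity)

end IsDiagonal

/-- The functions with this property form a closed subalgebra of `C(spectrum ℝ A, ℝ)` containing the
constants and the coordinate, hence everything by Stone–Weierstrass. Operators built by functional
calculus can therefore be read off in an eigenbasis. -/
theorem cfc_apply_of_eigenvector [CompleteSpace 𝓗] {A : 𝓗 →L[ℂ] 𝓗} (hA : IsSelfAdjoint A)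
    {f : ℝ → ℝ} (hf : ContinuousOn f (spectrum ℝ A)) {x : 𝓗} {c : ℝ} (hx : A x = (c : ℂ) • x) :
    cfc f A x = ((f c : ℝ) : ℂ) • x := by
  by_cases hx0 : x = 0
  · simp [hx0]
  -- If `c - A` were invertible, applying the inverse to `(c - A) x = 0` would give `x = 0`.
  have hc : c ∈ spectrum ℝ A := by
    intro hu
    rw [spectrum.mem_resolventSet_iff, Algebra.algebraMap_eq_smul_one] at hu
    obtain ⟨u, hu⟩ := hu
    have h1 : (u : 𝓗 →L[ℂ] 𝓗) x = 0 := by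
      rw [hu]
      simp [hx]
    have h2 : (((u⁻¹ : (𝓗 →L[ℂ] 𝓗)ˣ) : 𝓗 →L[ℂ] 𝓗) * u) x = 0 := by
      rw [mul_apply_eq_comp, h1, map_zero]
    rw [Units.inv_mul] at h2
    exact hx0 h2
  have key : ∀ g : C(spectrum ℝ A, ℝ), cfcHom (p := IsSelfAdjoint) hA g x = ((g ⟨c, hc⟩ : ℝ) : ℂ) • x := by
    intro g
    have : CompactSpace (spectrum ℝ A) := inferInstance
    induction g using ContinuousMap.induction_on_of_compact with
    | const r =>
      have : (ContinuousMap.const (spectrum ℝ A) r) = algebraMap ℝ C(spectrum ℝ A, ℝ) r := rfl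
      rw [this, AlgHomClass.commutes, Algebra.algebraMap_eq_smul_one]
      simp
    | id =>
      have h := cfcHom_id (R := ℝ) (p := IsSelfAdjoint) hA
      change cfcHom (p := IsSelfAdjoint) hA ((ContinuousMap.id ℝ).restrict _) x = _
      rw [h, hx]; rfl
    | star_id =>
      have h := cfcHom_id (R := ℝ) (p := IsSelfAdjoint) hA
      rw [map_star]
      change (star (cfcHom (p := IsSelfAdjoint) hA ((ContinuousMap.id ℝ).restrict _))) x = _
      rw [h, hA.star_eq, hx]; rfl
    | add f g hf hg => rw [map_add, add_apply, hf, hg, ← add_smul]; simp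
    | mul f g hf hg =>
      rw [map_mul, mul_apply_eq_comp, hg, map_smul, hf, smul_smul]
      simp [mul_comm]
    | frequently f hf =>
      have hcl : IsClosed {g : C(spectrum ℝ A, ℝ) |
          cfcHom (p := IsSelfAdjoint) hA g x = ((g ⟨c, hc⟩ : ℝ) : ℂ) • x} := by
        refine isClosed_eq ?_ ?_
        · exact (cfcHom_continuous (p := IsSelfAdjoint) hA).clm_apply continuous_const
        · exact (Complex.continuous_ofReal.comp
            (continuous_eval_const _)).smul continuous_const
      exact hcl.closure_subset (mem_closure_iff_frequently.2 hf)
  rw [cfc_apply f A hA hf, key]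
  rfl

namespace IsDiagonal

variable {ι : Type*} {b : HilbertBasis ι ℂ 𝓗} {a : ι → ℝ} {A : 𝓗 →L[ℂ] 𝓗} [CompleteSpace 𝓗]

theorem cfc (h : IsDiagonal b a A) {f : ℝ → ℝ} (hf : ContinuousOn f (spectrum ℝ A)) :
    IsDiagonal b (fun i => f (a i)) (cfc f A) := fun i =>
  cfc_apply_of_eigenvector h.isSelfAdjoint hf (h i)

theorem sqrt (h : IsDiagonal b a A) (ha : ∀ i, 0 ≤ a i) :
    IsDiagonal b (fun i => √(a i)) (CFC.sqrt A) := by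
  have hA : 0 ≤ A := (ContinuousLinearMap.nonneg_iff_isPositive A).2 (h.isPositive ha)
  rw [CFC.sqrt_eq_real_sqrt A hA, cfcₙ_eq_cfc]
  exact h.cfc (Real.continuous_sqrt.continuousOn)

theorem abs (h : IsDiagonal b a A) : IsDiagonal b (fun i => |a i|) (CFC.abs A) := by
  rw [CFC.abs_eq_cfc_norm A h.isSelfAdjoint]
  exact h.cfc continuous_norm.continuousOn

theorem posPart (h : IsDiagonal b a A) : IsDiagonal b (fun i => max (a i) 0) A⁺ := by
  rw [CFC.posPart_def, cfcₙ_eq_cfc]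
  exact h.cfc (f := fun x : ℝ => x⁺) continuous_posPart.continuousOn

theorem cutOff (h : IsDiagonal b a A) (ε : ℝ) :
    IsDiagonal b (fun i => max (a i - ε) 0) (cutOff A ε) := by
  refine IsDiagonal.posPart fun i => ?_
  simp [h i, sub_smul]

end IsDiagonal

/-- For summable `a` there is an operator which is diagonal in `b` with eigenvalues `a`. -/
theorem exists_isDiagonal [CompleteSpace 𝓗] {ι : Type*} (b : HilbertBasis ι ℂ 𝓗) {a : ι → ℝ}
    (ha : Summable a) : ∃ A, IsDiagonal b a A := by
  classical
  have hs : Summable fun i => (a i : ℂ) • InnerProductSpace.rankOne ℂ (b i) (b i) := by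
    refine Summable.of_norm ?_
    simpa [norm_smul, b.orthonormal.1] using ha.abs
  refine ⟨∑' i, (a i : ℂ) • InnerProductSpace.rankOne ℂ (b i) (b i), fun j => ?_⟩
  have h1 := hs.hasSum.mapL ((ContinuousLinearMap.apply ℂ 𝓗 (b j)))
  refine h1.unique ?_
  convert! hasSum_ite_eq j ((a j : ℂ) • b j) using 2 with i
  simp only [ContinuousLinearMap.apply_apply, smul_apply,
    InnerProductSpace.rankOne_apply, orthonormal_iff_ite.1 b.orthonormal i j]
  split_ifs with hij <;> simp [hij]

/-! ### Basis independence and additivity of the trace -/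

section Trace

variable [CompleteSpace 𝓗] {ι ι' : Type*}

/-- By Parseval both sides are the double sum of |⟨cⱼ, T bᵢ⟩|². As the two bases are unrelated, this
is the source of the basis independence of the trace. -/
theorem tsum_sq_norm_apply_eq_adjoint (b : HilbertBasis ι ℂ 𝓗) (c : HilbertBasis ι' ℂ 𝓗)
    (T : 𝓗 →L[ℂ] 𝓗) :
    ∑' i, ENNReal.ofReal (‖T (b i)‖ ^ 2) =
      ∑' j, ENNReal.ofReal (‖ContinuousLinearMap.adjoint T (c j)‖ ^ 2) := by
  simp_rw [← c.tsum_ofReal_sq_norm_inner (T _), ← b.tsum_ofReal_sq_norm_inner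
    (ContinuousLinearMap.adjoint T _)]
  rw [ENNReal.tsum_comm]
  refine tsum_congr fun j => tsum_congr fun i => ?_
  rw [ContinuousLinearMap.adjoint_inner_right, norm_inner_symm]

theorem re_inner_eq_sq_norm_sqrt {A : 𝓗 →L[ℂ] 𝓗} (hA : A.IsPositive) (x : 𝓗) :
    (inner ℂ x (A x)).re = ‖CFC.sqrt A x‖ ^ 2 := by
  have hA' : 0 ≤ A := (ContinuousLinearMap.nonneg_iff_isPositive A).2 hA
  have hs : (CFC.sqrt A).IsPositive :=
    (ContinuousLinearMap.nonneg_iff_isPositive _).1 (CFC.sqrt_nonneg A)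
  conv_lhs => rw [← CFC.sqrt_mul_sqrt_self A hA', mul_apply_eq_comp]
  rw [← hs.inner_left_eq_inner_right]
  exact inner_self_eq_norm_sq (𝕜 := ℂ) _

/-- The trace of a positive operator can be computed in every Hilbert basis. -/
theorem posTrace_eq_tsum {A : 𝓗 →L[ℂ] 𝓗} (hA : A.IsPositive) (c : HilbertBasis ι ℂ 𝓗) :
    posTrace A = ∑' i, ENNReal.ofReal (inner ℂ (c i) (A (c i))).re := by
  obtain ⟨b, hb⟩ := (exists_hilbertBasis ℂ 𝓗).choose_spec
  have hs : ContinuousLinearMap.adjoint (CFC.sqrt A) = CFC.sqrt A :=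
    ((ContinuousLinearMap.nonneg_iff_isPositive _).1 (CFC.sqrt_nonneg A)).isSelfAdjoint
  have h := tsum_sq_norm_apply_eq_adjoint b c (CFC.sqrt A)
  rw [hs, hb] at h
  simp_rw [posTrace, re_inner_eq_sq_norm_sqrt hA]
  exact h

theorem posTrace_adjoint_mul (T : 𝓗 →L[ℂ] 𝓗) (c : HilbertBasis ι ℂ 𝓗) :
    posTrace (ContinuousLinearMap.adjoint T * T) =
      ∑' i, ENNReal.ofReal (‖ContinuousLinearMap.adjoint T (c i)‖ ^ 2) := by
  have hT : (ContinuousLinearMap.adjoint T * T).IsPositive :=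
    ContinuousLinearMap.isPositive_adjoint_comp_self T
  rw [posTrace_eq_tsum hT c,
    ← tsum_sq_norm_apply_eq_adjoint c c]
  refine tsum_congr fun i => ?_
  rw [mul_apply_eq_comp, ContinuousLinearMap.adjoint_inner_right]
  exact congrArg _ (inner_self_eq_norm_sq (𝕜 := ℂ) _)

theorem posTrace_add {A B : 𝓗 →L[ℂ] 𝓗} (hA : A.IsPositive) (hB : B.IsPositive) :
    posTrace (A + B) = posTrace A + posTrace B := by
  simp only [posTrace]
  rw [← ENNReal.tsum_add]
  refine tsum_congr fun i => ?_
  rw [add_apply, inner_add_right, Complex.add_re, ENNReal.ofReal_add]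
  · exact hA.re_inner_nonneg_right _
  · exact hB.re_inner_nonneg_right _

theorem posTrace_smul {c : ℝ} (hc : 0 ≤ c) (A : 𝓗 →L[ℂ] 𝓗) :
    posTrace (c • A) = ENNReal.ofReal c * posTrace A := by
  simp only [posTrace]
  rw [← ENNReal.tsum_mul_left]
  refine tsum_congr fun i => ?_
  rw [smul_apply, inner_smul_right_eq_smul, Complex.smul_re, smul_eq_mul, ENNReal.ofReal_mul hc]

theorem IsDiagonal.posTrace_eq {b : HilbertBasis ι ℂ 𝓗} {a : ι → ℝ} {A : 𝓗 →L[ℂ] 𝓗}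
    (h : IsDiagonal b a A) (ha : ∀ i, 0 ≤ a i) : posTrace A = ∑' i, ENNReal.ofReal (a i) := by
  rw [posTrace_eq_tsum (h.isPositive ha) b]
  exact tsum_congr fun i => by rw [h.re_inner_basis]

end Trace

end DiagonalOperators

/-! ### Compactness and ordered eigenvalues of positive operators -/

section CompactPositiveOperators

variable {𝓗 : Type u} [NormedAddCommGroup 𝓗] [InnerProductSpace ℂ 𝓗] [CompleteSpace 𝓗]

omit [CompleteSpace 𝓗] in
theorem isCompactOperator_rankOne (x y : 𝓗) :
    IsCompactOperator (InnerProductSpace.rankOne ℂ x y) := by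
  rw [InnerProductSpace.rankOne_def']
  have h : IsCompactOperator (innerSL ℂ y : 𝓗 →L[ℂ] ℂ) :=
    isCompactOperator_of_locallyCompactSpace_dom (innerSL ℂ y : 𝓗 →L[ℂ] ℂ)
  exact h.clm_comp (ContinuousLinearMap.toSpanSingleton ℂ x)

/-- A Hilbert–Schmidt operator is compact. -/
theorem isCompactOperator_of_tsum_sq_norm_lt_top {ι : Type*} (b : HilbertBasis ι ℂ 𝓗)
    {S : 𝓗 →L[ℂ] 𝓗} (hS : IsSelfAdjoint S)
    (h : ∑' i, ENNReal.ofReal (‖S (b i)‖ ^ 2) ≠ ∞) : IsCompactOperator S := by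
  classical
  have hsum : Summable fun i => ‖S (b i)‖ ^ 2 := by
    have := ENNReal.summable_toReal h
    simpa [ENNReal.toReal_ofReal] using this
  -- `K F` is P_F S, with P_F the projection onto the span of the `b i`, `i ∈ F`. It has finite
  -- rank, and its distance to `S` is at most the Hilbert–Schmidt tail.
  let K : Finset ι → 𝓗 →L[ℂ] 𝓗 := fun F => ∑ i ∈ F, InnerProductSpace.rankOne ℂ (b i) (S (b i))
  have hK : ∀ F, IsCompactOperator (K F) := by
    intro F
    have : K F ∈ compactOperator (RingHom.id ℂ) 𝓗 𝓗 :=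
      Submodule.sum_mem _ fun i _ => isCompactOperator_rankOne _ _
    exact this
  have hin : ∀ F j x, inner ℂ (b j) ((S - K F) x) = if j ∈ F then 0 else inner ℂ (S (b j)) x := by
    intro F j x
    have h1 : inner ℂ (b j) (S x) = inner ℂ (S (b j)) x := by
      conv_rhs => rw [← hS.adjoint_eq, ContinuousLinearMap.adjoint_inner_left]
    simp only [K, sub_apply, sum_apply,
      InnerProductSpace.rankOne_apply, inner_sub_right, inner_sum, inner_smul_right, h1,
      orthonormal_iff_ite.1 b.orthonormal j, mul_ite, mul_one, mul_zero, Finset.sum_ite_eq]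
    split_ifs <;> simp
  have hbound : ∀ F x, ‖(S - K F) x‖ ^ 2 ≤ (∑' i : {i // i ∉ F}, ‖S (b i)‖ ^ 2) * ‖x‖ ^ 2 := by
    intro F x
    have h1 := b.hasSum_sq_norm_inner ((S - K F) x)
    simp only [hin] at h1
    have h2 : HasSum (fun i : {i // i ∉ F} => ‖inner ℂ (S (b i)) x‖ ^ 2) (‖(S - K F) x‖ ^ 2) := by
      have h3 : Function.support (fun j => ‖if j ∈ F then (0 : ℂ) else inner ℂ (S (b j)) x‖ ^ 2) ⊆
          {i | i ∉ F} := by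
        intro j hj hjF
        simp [hjF] at hj
      have h5 : (fun i : {i // i ∉ F} => ‖inner ℂ (S (b i)) x‖ ^ 2) =
          (fun j => ‖if j ∈ F then (0 : ℂ) else inner ℂ (S (b j)) x‖ ^ 2) ∘ Subtype.val := by
        ext i
        simp only [Function.comp_apply, if_neg i.2]
      rw [h5]
      exact (hasSum_subtype_iff_of_support_subset h3).2 h1
    rw [← tsum_mul_right]
    refine hasSum_le (fun i => ?_) h2 ((hsum.subtype _).mul_right _).hasSum
    rw [Function.comp_apply, ← mul_pow]
    gcongr
    exact norm_inner_le_norm _ _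
  have hlim : Filter.Tendsto K Filter.atTop (nhds S) := by
    rw [tendsto_iff_norm_sub_tendsto_zero]
    have h1 : Filter.Tendsto (fun F : Finset ι => √(∑' i : {i // i ∉ F}, ‖S (b i)‖ ^ 2))
        Filter.atTop (nhds 0) := by
      have := (tendsto_tsum_compl_atTop_zero (fun i => ‖S (b i)‖ ^ 2))
      have h2 := (Real.continuous_sqrt.tendsto 0).comp this
      rwa [Real.sqrt_zero] at h2
    refine squeeze_zero (fun _ => norm_nonneg _) (fun F => ?_) h1
    rw [norm_sub_rev]
    refine ContinuousLinearMap.opNorm_le_bound _ (Real.sqrt_nonneg _) fun x => ?_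
    rw [← Real.sqrt_sq (norm_nonneg x), ← Real.sqrt_mul (tsum_nonneg fun _ => by positivity)]
    exact Real.le_sqrt_of_sq_le (hbound F x)
  exact isCompactOperator_of_tendsto hlim (Filter.Eventually.of_forall hK)

/-- The square root of `A` is Hilbert–Schmidt, with squared norm Tr A. -/
theorem isCompactOperator_of_posTrace_ne_top {A : 𝓗 →L[ℂ] 𝓗} (hA : A.IsPositive)
    (h : posTrace A ≠ ∞) : IsCompactOperator A := by
  obtain ⟨w, b, -⟩ := exists_hilbertBasis ℂ 𝓗
  have hA' : 0 ≤ A := (ContinuousLinearMap.nonneg_iff_isPositive A).2 hA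
  rw [posTrace_eq_tsum hA b] at h
  simp_rw [re_inner_eq_sq_norm_sqrt hA] at h
  have hS : IsSelfAdjoint (CFC.sqrt A) :=
    ((ContinuousLinearMap.nonneg_iff_isPositive _).1 (CFC.sqrt_nonneg A)).isSelfAdjoint
  have := (isCompactOperator_of_tsum_sq_norm_lt_top b hS h).clm_comp (CFC.sqrt A)
  rw [← CFC.sqrt_mul_sqrt_self A hA']
  exact this

theorem cutOff_eq_cfc {A : 𝓗 →L[ℂ] 𝓗} (hA : IsSelfAdjoint A) (δ : ℝ) :
    cutOff A δ = cfc (fun x : ℝ => max (x - δ) 0) A := by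
  have h1 : A - (δ : ℂ) • ContinuousLinearMap.id ℂ 𝓗 = cfc (fun x : ℝ => x - δ) A := by
    rw [cfc_sub (fun x => x) (fun _ => δ) A, cfc_id' ℝ A, cfc_const δ A,
      Algebra.algebraMap_eq_smul_one]
    rfl
  rw [cutOff, h1, CFC.posPart_def, cfcₙ_eq_cfc continuous_posPart.continuousOn,
    ← cfc_comp' (fun x : ℝ => x⁺) (fun x : ℝ => x - δ) A]
  rfl

theorem norm_sub_cutOff_le {A : 𝓗 →L[ℂ] 𝓗} (hA : A.IsPositive) {δ : ℝ} (hδ : 0 ≤ δ) :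
    ‖A - cutOff A δ‖ ≤ δ := by
  have hA' : 0 ≤ A := (ContinuousLinearMap.nonneg_iff_isPositive A).2 hA
  have hsa := hA.isSelfAdjoint
  have h0 := cutOff_eq_cfc hsa δ
  have h2 : A - cutOff A δ = cfc (fun x : ℝ => x - max (x - δ) 0) A := by
    rw [h0, cfc_sub (fun x : ℝ => x) (fun x : ℝ => max (x - δ) 0) A, cfc_id' ℝ A]
  rw [h2]
  refine norm_cfc_le hδ fun x hx => ?_
  have hx0 : 0 ≤ x := spectrum_nonneg_of_nonneg hA' hx
  rw [Real.norm_eq_abs, abs_le]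
  rcases max_cases (x - δ) 0 with h | h <;> constructor <;> linarith

theorem cutOff_nonneg (A : 𝓗 →L[ℂ] 𝓗) (δ : ℝ) : (cutOff A δ).IsPositive :=
  (ContinuousLinearMap.nonneg_iff_isPositive _).1 (CFC.posPart_nonneg _)

/-- `A` is the norm limit of its trace-class cut-offs. This covers the resolvent of `H`, which need
not be trace class: under the Gibbs condition the numbers 1/(1 + Eₖ) may fail to be summable. -/
theorem isCompactOperator_of_posTrace_cutOff {A : 𝓗 →L[ℂ] 𝓗} (hA : A.IsPositive)
    (h : ∀ δ : ℝ, 0 < δ → posTrace (cutOff A δ) ≠ ∞) : IsCompactOperator A := by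
  refine isCompactOperator_of_tendsto (ι := ℕ) (l := Filter.atTop)
    (F := fun n => cutOff A (1 / ((n : ℝ) + 1))) ?_ (Filter.Eventually.of_forall fun n =>
      isCompactOperator_of_posTrace_ne_top (cutOff_nonneg _ _) (h _ (by positivity)))
  rw [tendsto_iff_norm_sub_tendsto_zero]
  refine squeeze_zero (fun _ => norm_nonneg _) (fun n => ?_)
    tendsto_one_div_add_atTop_nhds_zero_nat
  rw [norm_sub_rev]
  exact norm_sub_cutOff_le hA (by positivity)

open scoped ComplexOrder in
/-- A compact positive operator has a Hilbert basis of eigenvectors. -/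
theorem exists_isDiagonal_of_isCompactOperator {A : 𝓗 →L[ℂ] 𝓗} (hA : A.IsPositive)
    (hc : IsCompactOperator A) :
    ∃ (ι : Type u) (b : HilbertBasis ι ℂ 𝓗) (a : ι → ℝ), (∀ i, 0 ≤ a i) ∧ IsDiagonal b a A := by
  let V : ℂ → Submodule ℂ 𝓗 := fun μ => Module.End.eigenspace (A : Module.End ℂ 𝓗) μ
  have hV : ∀ μ, IsClosed (V μ : Set 𝓗) := by
    intro μ
    have : (V μ : Set 𝓗) = {x | A x = μ • x} := by
      ext x
      simp [V]
    rw [this]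
    exact isClosed_eq A.continuous (continuous_const_smul μ)
  have hVc : ∀ μ, CompleteSpace (V μ) := fun μ => (hV μ).completeSpace_coe
  -- The value `μ = 0` is included, so a basis of the kernel takes part and the union of the bases
  -- is total.
  choose w B hB using fun μ => exists_hilbertBasis ℂ (V μ)
  have hof := hA.isSymmetric.orthogonalFamily_eigenspaces
  have hon : Orthonormal ℂ (fun i : (Σ μ, w μ) => ((B i.1 i.2 : V i.1) : 𝓗)) :=
    hof.orthonormal_sigma_orthonormal fun μ => (B μ).orthonormal
  have hsp : (Submodule.span ℂ (Set.range fun i : (Σ μ, w μ) => ((B i.1 i.2 : V i.1) : 𝓗)))ᗮ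
      = ⊥ := by
    rw [← ContinuousLinearMap.orthogonalComplement_iSup_eigenspaces_eq_bot hc hA.isSymmetric,
      eq_comm]
    apply le_antisymm
    · apply Submodule.orthogonal_le
      rw [Submodule.span_le]
      rintro _ ⟨i, rfl⟩
      exact Submodule.mem_iSup_of_mem i.1 (B i.1 i.2 : V i.1).2
    · intro x hx
      rw [Submodule.mem_orthogonal'] at hx ⊢
      have : (⨆ μ, Module.End.eigenspace (A : Module.End ℂ 𝓗) μ) ≤ (Submodule.span ℂ {x})ᗮ := by
        refine iSup_le fun μ y hy => ?_
        rw [Submodule.mem_orthogonal_singleton_iff_inner_right]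
        have h1 := ((B μ).hasSum_repr ⟨y, hy⟩).mapL (V μ).subtypeL
        have h2 := h1.mapL (innerSL ℂ x)
        refine h2.unique ?_
        convert! hasSum_zero with i
        have h3 : inner ℂ x ((B μ i : V μ) : 𝓗) = 0 :=
          hx _ (Submodule.subset_span ⟨⟨μ, i⟩, rfl⟩)
        simp only [map_smul, Submodule.subtypeL_apply, innerSL_apply_apply, h3, smul_zero]
      intro y hy
      exact Submodule.mem_orthogonal_singleton_iff_inner_right.1 (this hy)
  let b := HilbertBasis.mkOfOrthogonalEqBot hon hsp
  have hb : ∀ i, A (b i) = i.1 • b i := by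
    intro i
    have : b i = ((B i.1 i.2 : V i.1) : 𝓗) := by
      rw [HilbertBasis.coe_mkOfOrthogonalEqBot]
    rw [this]
    exact Module.End.mem_eigenspace_iff.1 (B i.1 i.2 : V i.1).2
  have hnn : ∀ i : (Σ μ, w μ), 0 ≤ i.1 := by
    intro i
    have h := hA.inner_nonneg_right (b i)
    rwa [hb, inner_smul_right, inner_self_eq_norm_sq_to_K, b.orthonormal.1 i, RCLike.ofReal_one, one_pow,
      mul_one] at h
  refine ⟨_, b, fun i => i.1.re, fun i => (Complex.nonneg_iff.1 (hnn i)).1, fun i => ?_⟩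
  rw [hb]
  congr 1
  exact (Complex.ext rfl (by simpa using (Complex.nonneg_iff.1 (hnn i)).2.symm) )

/-- A nonnegative family on an infinite set which is only finitely often above each positive level
can be arranged in nonincreasing order, up to zeros. -/
theorem exists_antitone_enumeration {ι : Type*} [Infinite ι] {a : ι → ℝ} (ha : ∀ i, 0 ≤ a i)
    (hfin : ∀ c, 0 < c → {i | c ≤ a i}.Finite) :
    ∃ e : ℕ → ι, Function.Injective e ∧ Antitone (a ∘ e) ∧ ∀ j ∉ Set.range e, a j = 0 := by
  classical
  -- Greedy selection: outside a finite set a maximal value exists, since either finitely many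
  -- indices compete with some positive value or all remaining values are zero.
  have hmax : ∀ s : Finset ι, ∃ i, i ∉ s ∧ ∀ j, j ∉ s → a j ≤ a i := by
    intro s
    by_cases h : ∃ i, i ∉ s ∧ 0 < a i
    · obtain ⟨i, his, hi⟩ := h
      let F := (hfin (a i) hi).toFinset \ s
      obtain ⟨m, hm, hmm⟩ := F.exists_max_image a ⟨i, by simp [F, his]⟩
      have hm' : a i ≤ a m ∧ m ∉ s := by simpa [F] using hm
      refine ⟨m, hm'.2, fun j hj => ?_⟩
      rcases le_total (a i) (a j) with h | h
      · exact hmm j (by simp [F, hj, h])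
      · exact h.trans hm'.1
    · push Not at h
      obtain ⟨i, hi⟩ := Infinite.exists_notMem_finset s
      exact ⟨i, hi, fun j hj => (h j hj).trans (ha i)⟩
  choose f hf hfm using hmax
  let s : ℕ → Finset ι := fun n => Nat.rec ∅ (fun _ t => insert (f t) t) n
  have hs : ∀ n, s (n + 1) = insert (f (s n)) (s n) := fun n => rfl
  have hmono : Monotone s := monotone_nat_of_le_succ fun n => by
    rw [hs]; exact Finset.subset_insert _ _
  have hmem : ∀ {m n}, m < n → f (s m) ∈ s n := fun {m n} h =>
    hmono (Nat.succ_le_of_lt h) (by rw [hs]; exact Finset.mem_insert_self _ _)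
  have hrange : ∀ n, ∀ j ∈ s n, j ∈ Set.range fun n => f (s n) := by
    intro n
    induction n with
    | zero => intro j hj; exact absurd hj (Finset.notMem_empty j)
    | succ n ih =>
      intro j hj
      rw [hs, Finset.mem_insert] at hj
      rcases hj with rfl | hj
      · exact ⟨n, rfl⟩
      · exact ih j hj
  have hinj : Function.Injective fun n => f (s n) := by
    intro m n h
    by_contra hne
    rcases Nat.lt_or_gt_of_ne hne with hlt | hlt
    · exact hf (s n) (by have := hmem hlt; rwa [show f (s m) = f (s n) from h] at this)
    · exact hf (s m) (by have := hmem hlt; rwa [← show f (s m) = f (s n) from h] at this)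
  refine ⟨fun n => f (s n), hinj, antitone_nat_of_succ_le fun n => ?_, fun j hj => ?_⟩
  · exact hfm _ _ fun h => hf (s (n + 1)) (hmono (Nat.le_succ n) h)
  · by_contra h0
    -- A positive value never selected would lie below infinitely many selected ones, against
    -- `hfin`.
    have hpos : 0 < a j := lt_of_le_of_ne (ha j) (Ne.symm h0)
    refine Set.infinite_range_of_injective hinj ((hfin _ hpos).subset ?_)
    rintro _ ⟨n, rfl⟩
    exact hfm _ _ fun h => hj (hrange n j h)

omit [CompleteSpace 𝓗] in
theorem HilbertBasis.infinite {ι : Type*} (b : HilbertBasis ι ℂ 𝓗)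
    (h : ¬ FiniteDimensional ℂ 𝓗) : Infinite ι := by
  by_contra hfin
  rw [not_infinite_iff_finite] at hfin
  have : FiniteDimensional ℂ (Submodule.span ℂ (Set.range b)) :=
    FiniteDimensional.span_of_finite ℂ (Set.finite_range b)
  have h1 := b.dense_span
  rw [(Submodule.closed_of_finiteDimensional _).submodule_topologicalClosure_eq] at h1
  rw [h1] at this
  exact h (Module.Finite.equiv Submodule.topEquiv)

theorem finite_setOf_le_of_tsum_ne_top {ι : Type*} {a : ι → ℝ} {δ c : ℝ} (hδ : δ < c)
    (h : ∑' i, ENNReal.ofReal (max (a i - δ) 0) ≠ ∞) : {i | c ≤ a i}.Finite := by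
  have := ENNReal.finite_const_le_of_tsum_ne_top h (ε := ENNReal.ofReal (c - δ))
    (by simpa using hδ)
  refine this.subset fun i hi => ?_
  exact ENNReal.ofReal_le_ofReal (le_max_of_le_left (by simpa using hi))

theorem exists_isDecreasingEigenvalueSeq_of_cutOff (hinf : ¬ FiniteDimensional ℂ 𝓗)
    {A : 𝓗 →L[ℂ] 𝓗} (hA : A.IsPositive)
    (h : ∀ δ : ℝ, 0 < δ → posTrace (cutOff A δ) ≠ ∞) : ∃ lam, IsDecreasingEigenvalueSeq A lam := by
  obtain ⟨ι, b, a, ha, hd⟩ := exists_isDiagonal_of_isCompactOperator hA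
    (isCompactOperator_of_posTrace_cutOff hA h)
  have := b.infinite hinf
  obtain ⟨e, he, hanti, hz⟩ := exists_antitone_enumeration ha fun c hc =>
    finite_setOf_le_of_tsum_ne_top (half_lt_self hc) (by
      rw [← (hd.cutOff (c / 2)).posTrace_eq fun _ => le_max_right _ _]
      exact h _ (half_pos hc))
  refine ⟨a ∘ e, hanti, b ∘ e, b.orthonormal.comp e he, fun x => ?_⟩
  exact (he.hasSum_iff (f := fun i => ((a i : ℂ) * inner ℂ (b i) x) • b i)
    fun j hj => by simp [hz j hj]).2 (hd.hasSum_apply x)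

theorem posTrace_mono {A B : 𝓗 →L[ℂ] 𝓗}
    (h : ∀ x, (inner ℂ x (A x)).re ≤ (inner ℂ x (B x)).re) : posTrace A ≤ posTrace B :=
  ENNReal.tsum_le_tsum fun _ => ENNReal.ofReal_le_ofReal (h _)

theorem exists_isDecreasingEigenvalueSeq (hinf : ¬ FiniteDimensional ℂ 𝓗)
    {A : 𝓗 →L[ℂ] 𝓗} (hA : A.IsPositive) (h : posTrace A ≠ ∞) :
    ∃ lam, IsDecreasingEigenvalueSeq A lam := by
  obtain ⟨ι, b, a, ha, hd⟩ := exists_isDiagonal_of_isCompactOperator hA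
    (isCompactOperator_of_posTrace_ne_top hA h)
  refine exists_isDecreasingEigenvalueSeq_of_cutOff hinf hA fun δ hδ => ne_top_of_le_ne_top h ?_
  rw [(hd.cutOff δ).posTrace_eq fun _ => le_max_right _ _, hd.posTrace_eq ha]
  exact ENNReal.tsum_le_tsum fun i => ENNReal.ofReal_le_ofReal
    (max_le (by linarith) (ha i))

theorem IsDecreasingEigenvalueSeq.exists_isDiagonal {A : 𝓗 →L[ℂ] 𝓗} {lam : ℕ → ℝ}
    (h : IsDecreasingEigenvalueSeq A lam) :
    ∃ (κ : Set 𝓗) (b : HilbertBasis (ℕ ⊕ κ) ℂ 𝓗),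
      IsDiagonal b (Sum.elim lam (fun _ => 0)) A := by
  obtain ⟨-, φ, hφ, hs⟩ := h
  obtain ⟨κ, b, hb⟩ := hφ.exists_hilbertBasis_sum
  refine ⟨κ, b, fun i => (hs (b i)).unique ?_⟩
  classical
  have ho := orthonormal_iff_ite.1 b.orthonormal
  simp_rw [← hb, ho]
  rcases i with j | j
  · convert! hasSum_ite_eq j ((lam j : ℂ) • b (Sum.inl j)) using 2 with k
    by_cases hkj : k = j <;> simp [hkj]
  · simp [hasSum_zero]

end CompactPositiveOperators

/-! ### Weyl monotonicity and Mirsky's inequality -/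

section EigenvalueInequalities

variable {𝓗 : Type u} [NormedAddCommGroup 𝓗] [InnerProductSpace ℂ 𝓗]

/-- Weyl's monotonicity principle for ordered eigenvalues. -/
theorem eigenvalue_mono {κ κ' : Type*} {b : HilbertBasis (ℕ ⊕ κ) ℂ 𝓗}
    {c : HilbertBasis (ℕ ⊕ κ') ℂ 𝓗} {lam nu : ℕ → ℝ} {A C : 𝓗 →L[ℂ] 𝓗}
    (hA : IsDiagonal b (Sum.elim lam fun _ => 0) A) (hC : IsDiagonal c (Sum.elim nu fun _ => 0) C)
    (hlam : Antitone lam) (hnu : Antitone nu) (hnu0 : ∀ k, 0 ≤ nu k)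
    (hle : ∀ x, (inner ℂ x (A x)).re ≤ (inner ℂ x (C x)).re) (k : ℕ) : lam k ≤ nu k := by
  classical
  -- Courant–Fischer: by dimension count, some nonzero combination of the `k + 1` leading
  -- eigenvectors of `A` is orthogonal to the `k` leading ones of `C`. On it the form of `A` is at
  -- least `lam k` and that of `C` at most `nu k`.
  let L : (Fin (k + 1) → ℂ) →ₗ[ℂ] 𝓗 :=
    Fintype.linearCombination ℂ (fun i : Fin (k + 1) => b (Sum.inl i))
  let f : (Fin (k + 1) → ℂ) →ₗ[ℂ] (Fin k → ℂ) :=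
    LinearMap.pi fun j => (innerₛₗ ℂ (c (Sum.inl j))).comp L
  obtain ⟨v, hv, hv0⟩ := (Submodule.ne_bot_iff _).1
    (LinearMap.ker_ne_bot_of_finrank_lt (f := f) (by simp))
  have hL : L v = ∑ i : Fin (k + 1), v i • b (Sum.inl i) := rfl
  have ho := orthonormal_iff_ite.1 b.orthonormal
  have hbL : ∀ i : Fin (k + 1), inner ℂ (b (Sum.inl i)) (L v) = v i := by
    intro i
    rw [hL, inner_sum]
    simp only [inner_smul_right, ho, Sum.inl.injEq, Fin.val_inj, mul_ite, mul_one, mul_zero]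
    simp
  have hbL0 : ∀ i, (∀ j : Fin (k + 1), i ≠ Sum.inl (j : ℕ)) → inner ℂ (b i) (L v) = 0 := by
    intro i hi
    rw [hL, inner_sum]
    refine Finset.sum_eq_zero fun j _ => ?_
    rw [inner_smul_right, ho, if_neg (hi j), mul_zero]
  have hcL : ∀ j, j < k → inner ℂ (c (Sum.inl j)) (L v) = 0 := by
    intro j hj
    exact congrFun (LinearMap.mem_ker.1 hv) ⟨j, hj⟩
  have hx0 : 0 < ‖L v‖ ^ 2 := by
    obtain ⟨i, hi⟩ := Function.ne_iff.1 hv0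
    have : L v ≠ 0 := by
      intro h
      apply hi
      rw [← hbL i, h, inner_zero_right]
      rfl
    positivity
  have h1 : lam k * ‖L v‖ ^ 2 ≤ (inner ℂ (L v) (A (L v))).re := by
    refine hasSum_le (fun i => ?_) ((b.hasSum_sq_norm_inner (L v)).mul_left (lam k))
      (hA.hasSum_re_inner (L v))
    by_cases hi : ∃ j : Fin (k + 1), i = Sum.inl (j : ℕ)
    · obtain ⟨j, rfl⟩ := hi
      exact mul_le_mul_of_nonneg_right (hlam (Nat.lt_succ_iff.1 j.2)) (by positivity)
    · push Not at hi
      rw [hbL0 i hi]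
      simp
  have h2 : (inner ℂ (L v) (C (L v))).re ≤ nu k * ‖L v‖ ^ 2 := by
    refine hasSum_le (fun i => ?_) (hC.hasSum_re_inner (L v))
      ((c.hasSum_sq_norm_inner (L v)).mul_left (nu k))
    rcases i with j | j
    · rcases lt_or_ge j k with hj | hj
      · rw [hcL j hj]; simp
      · exact mul_le_mul_of_nonneg_right (hnu hj) (by positivity)
    · exact mul_le_mul_of_nonneg_right (hnu0 k) (by positivity)
  exact le_of_mul_le_mul_right (h1.trans ((hle _).trans h2)) hx0

theorem ENNReal.tsum_sum_type {α β : Type*} (f : α ⊕ β → ℝ≥0∞) :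
    ∑' i, f i = ∑' a, f (Sum.inl a) + ∑' b, f (Sum.inr b) :=
  (HasSum.sum ENNReal.summable.hasSum ENNReal.summable.hasSum).tsum_eq

variable [CompleteSpace 𝓗]

omit [CompleteSpace 𝓗] in
theorem IsDiagonal.nonneg {ι : Type*} {b : HilbertBasis ι ℂ 𝓗} {a : ι → ℝ} {A : 𝓗 →L[ℂ] 𝓗}
    (h : IsDiagonal b a A) (hA : A.IsPositive) (i : ι) : 0 ≤ a i := by
  rw [← h.re_inner_basis i]
  exact hA.re_inner_nonneg_right _

theorem IsDiagonal.posTrace_elim {κ : Type*} {b : HilbertBasis (ℕ ⊕ κ) ℂ 𝓗} {a : ℕ → ℝ}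
    {A : 𝓗 →L[ℂ] 𝓗} (h : IsDiagonal b (Sum.elim a fun _ => 0) A) (ha : ∀ k, 0 ≤ a k) :
    posTrace A = ∑' k, ENNReal.ofReal (a k) := by
  rw [h.posTrace_eq (by rintro (i | i) <;> simp [ha]), ENNReal.tsum_sum_type]
  simp

/-- **Mirsky's inequality** for positive trace-class operators. -/
theorem tsum_abs_eigenvalue_sub_le_traceNorm {ρ σ : 𝓗 →L[ℂ] 𝓗} (hρ : ρ.IsPositive)
    (hσ : σ.IsPositive) (hρt : posTrace ρ ≠ ∞) (hσt : posTrace σ ≠ ∞) {κ κ' : Type*}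
    {b : HilbertBasis (ℕ ⊕ κ) ℂ 𝓗} {c : HilbertBasis (ℕ ⊕ κ') ℂ 𝓗} {lam mu : ℕ → ℝ}
    (hb : IsDiagonal b (Sum.elim lam fun _ => 0) ρ) (hc : IsDiagonal c (Sum.elim mu fun _ => 0) σ)
    (hlam : Antitone lam) (hmu : Antitone mu) :
    ∑' k, ENNReal.ofReal |lam k - mu k| ≤ traceNorm (ρ - σ) := by
  have hT : IsSelfAdjoint (ρ - σ) := hρ.isSelfAdjoint.sub hσ.isSelfAdjoint
  have hp : ((ρ - σ)⁺).IsPositive :=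
    (ContinuousLinearMap.nonneg_iff_isPositive _).1 (CFC.posPart_nonneg _)
  have hn : ((ρ - σ)⁻).IsPositive :=
    (ContinuousLinearMap.nonneg_iff_isPositive _).1 (CFC.negPart_nonneg _)
  have htn : traceNorm (ρ - σ) = posTrace (ρ - σ)⁺ + posTrace (ρ - σ)⁻ := by
    rw [traceNorm, ← CFC.posPart_add_negPart (ρ - σ) hT, posTrace_add hp hn]
  by_cases htop : traceNorm (ρ - σ) = ∞
  · rw [htop]; exact le_top
  -- This operator dominates both ρ and σ, so its eigenvalues ν dominate λ and μ, and |λ - μ| + λ +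
  -- μ ≤ 2ν. Twice its trace is Tr ρ + Tr σ + ‖ρ - σ‖₁.
  have hC : σ + (ρ - σ)⁺ = ρ + (ρ - σ)⁻ := by
    have h := CFC.posPart_sub_negPart (ρ - σ) hT
    rw [sub_eq_sub_iff_add_eq_add] at h
    rw [add_comm, h]
  have hCp : (ρ + (ρ - σ)⁻).IsPositive := hρ.add hn
  have hCt1 : posTrace (ρ + (ρ - σ)⁻) = posTrace ρ + posTrace (ρ - σ)⁻ := posTrace_add hρ hn
  have hCt2 : posTrace (ρ + (ρ - σ)⁻) = posTrace σ + posTrace (ρ - σ)⁺ := by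
    rw [← hC]; exact posTrace_add hσ hp
  have hpt : posTrace (ρ - σ)⁻ ≠ ∞ := fun h => htop (by rw [htn, h, add_top])
  have hinf : ¬ FiniteDimensional ℂ 𝓗 := fun hfd =>
    not_finite_iff_infinite.2 inferInstance
      ((b.orthonormal.linearIndependent.finite : Finite (ℕ ⊕ κ)))
  obtain ⟨nu, hnu⟩ := exists_isDecreasingEigenvalueSeq hinf hCp
    (by rw [hCt1]; exact ENNReal.add_ne_top.2 ⟨hρt, hpt⟩)
  obtain ⟨κ'', d, hd⟩ := hnu.exists_isDiagonal
  have hnu0 : ∀ k, 0 ≤ nu k := fun k => hd.nonneg hCp (Sum.inl k)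
  have hlam0 : ∀ k, 0 ≤ lam k := fun k => hb.nonneg hρ (Sum.inl k)
  have hmu0 : ∀ k, 0 ≤ mu k := fun k => hc.nonneg hσ (Sum.inl k)
  have h1 : ∀ k, lam k ≤ nu k := eigenvalue_mono hb hd hlam hnu.1 hnu0 fun x => by
    rw [add_apply, inner_add_right, Complex.add_re]
    exact le_add_of_nonneg_right (hn.re_inner_nonneg_right x)
  have h2 : ∀ k, mu k ≤ nu k := eigenvalue_mono hc hd hmu hnu.1 hnu0 fun x => by
    rw [← hC, add_apply, inner_add_right, Complex.add_re]
    exact le_add_of_nonneg_right (hp.re_inner_nonneg_right x)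
  have h3 : ∑' k, ENNReal.ofReal |lam k - mu k| + (posTrace ρ + posTrace σ) ≤
      traceNorm (ρ - σ) + (posTrace ρ + posTrace σ) := by
    calc _ = ∑' k, (ENNReal.ofReal |lam k - mu k| + (ENNReal.ofReal (lam k) +
          ENNReal.ofReal (mu k))) := by
          rw [ENNReal.tsum_add, ENNReal.tsum_add, hb.posTrace_elim hlam0, hc.posTrace_elim hmu0]
      _ ≤ ∑' k, (ENNReal.ofReal (nu k) + ENNReal.ofReal (nu k)) := by
          refine ENNReal.tsum_le_tsum fun k => ?_
          rw [← ENNReal.ofReal_add (hlam0 k) (hmu0 k), ← ENNReal.ofReal_add (hnu0 k) (hnu0 k),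
            ← ENNReal.ofReal_add (abs_nonneg _) (add_nonneg (hlam0 k) (hmu0 k))]
          refine ENNReal.ofReal_le_ofReal ?_
          have := h1 k
          have := h2 k
          rcases abs_cases (lam k - mu k) with h | h <;> linarith
      _ = posTrace (ρ + (ρ - σ)⁻) + posTrace (ρ + (ρ - σ)⁻) := by
          rw [ENNReal.tsum_add, hd.posTrace_elim hnu0]
      _ = _ := by
          nth_rewrite 1 [hCt1]
          rw [hCt2, htn]
          ring
  exact (ENNReal.add_le_add_iff_right (ENNReal.add_ne_top.2 ⟨hρt, hσt⟩)).1 h3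

end EigenvalueInequalities

/-! ### The resolvent and the discrete spectrum of H -/

namespace PositiveOperator

variable {𝓗 : Type u} [NormedAddCommGroup 𝓗] [InnerProductSpace ℂ 𝓗] [CompleteSpace 𝓗]
  (H : PositiveOperator 𝓗)

theorem isResolvent_resolvent : H.IsResolvent H.resolvent := H.exists_isResolvent.choose_spec

theorem resolvent_mem (ψ : 𝓗) : H.resolvent ψ ∈ H.op.domain := (H.isResolvent_resolvent ψ).1

theorem inner_resolvent_eq (ψ : 𝓗) (y : H.op.domain) :
    inner ℂ (y : 𝓗) ψ =
      inner ℂ (y : 𝓗) (H.resolvent ψ + H.op ⟨H.resolvent ψ, H.resolvent_mem ψ⟩) := by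
  obtain ⟨h, hy⟩ := H.isResolvent_resolvent ψ
  have := hy y y.2
  rwa [inner_sub_right, sub_eq_zero] at this

omit [CompleteSpace 𝓗] in
theorem addId_mem_closure (x : H.op.domain) :
    (x : 𝓗) + H.op x ∈ H.op.domain.topologicalClosure :=
  Submodule.add_mem _ (H.op.domain.le_topologicalClosure x.2) (H.map_mem x)

/-- The weak equation has one solution: the difference z of two satisfies z + Hz = 0, and
`norm_le_norm_add` forces z = 0. -/
theorem resolvent_eq_of_inner_eq (ψ : 𝓗) (x : H.op.domain)
    (h : ∀ y : H.op.domain, inner ℂ (y : 𝓗) ψ = inner ℂ (y : 𝓗) ((x : 𝓗) + H.op x)) :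
    H.resolvent ψ = x := by
  set z : H.op.domain := ⟨H.resolvent ψ, H.resolvent_mem ψ⟩ with hz
  have h1 : ((z - x : H.op.domain) : 𝓗) + H.op (z - x) = 0 := by
    refine H.eq_zero_of_inner_eq_zero (H.addId_mem_closure _) fun y => ?_
    have h2 := H.inner_resolvent_eq ψ y
    rw [h y, eq_comm, ← sub_eq_zero, ← inner_sub_right] at h2
    rw [← h2, LinearPMap.map_sub]
    congr 1
    push_cast
    rw [hz]
    abel
  have h2 := H.norm_le_norm_add (z - x)
  rw [h1, norm_zero, norm_le_zero_iff] at h2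
  exact sub_eq_zero.1 (by simpa using h2)

theorem resolvent_add (x : H.op.domain) : H.resolvent ((x : 𝓗) + H.op x) = x :=
  H.resolvent_eq_of_inner_eq _ x fun _ => rfl

theorem resolvent_eq_zero {ψ : 𝓗} (h : ∀ y : H.op.domain, inner ℂ (y : 𝓗) ψ = 0) :
    H.resolvent ψ = 0 :=
  H.resolvent_eq_of_inner_eq ψ 0 fun y => by simp [h y]

theorem isPositive_resolvent : H.resolvent.IsPositive := by
  refine ⟨fun ψ ψ' => ?_, fun ψ => ?_⟩
  · set x : H.op.domain := ⟨H.resolvent ψ, H.resolvent_mem ψ⟩ with hx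
    set x' : H.op.domain := ⟨H.resolvent ψ', H.resolvent_mem ψ'⟩ with hx'
    have h1 := H.inner_resolvent_eq ψ' x
    have h2 := H.inner_resolvent_eq ψ x'
    change inner ℂ (x : 𝓗) ψ' = inner ℂ ψ (x' : 𝓗)
    rw [h1, ← inner_conj_symm ψ, h2, inner_conj_symm]
    change inner ℂ (x : 𝓗) ((x' : 𝓗) + H.op x') = inner ℂ ((x : 𝓗) + H.op x) (x' : 𝓗)
    rw [inner_add_right, inner_add_left, H.symmetric]
  · set x : H.op.domain := ⟨H.resolvent ψ, H.resolvent_mem ψ⟩ with hx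
    have h1 := H.inner_resolvent_eq ψ x
    change 0 ≤ (inner ℂ (x : 𝓗) ψ).re
    rw [h1]
    change 0 ≤ (inner ℂ (x : 𝓗) ((x : 𝓗) + H.op x)).re
    rw [inner_add_right, Complex.add_re]
    exact add_nonneg (inner_self_nonneg (𝕜 := ℂ)) (H.nonneg x)

/-- `t` is a Hilbert basis of eigenvectors of `H` with eigenvalues `en`, completed by vectors
orthogonal to the domain of `H`. -/
structure IsEigenbasis {κ : Type*} (en : ℕ → ℝ) (t : HilbertBasis (ℕ ⊕ κ) ℂ 𝓗) : Prop where
  nonneg : ∀ k, 0 ≤ en k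
  isDiagonal : IsDiagonal t (Sum.elim (fun k => 1 / (1 + en k)) fun _ => 0) H.resolvent

variable {H}

/-- An eigenvalue E of `H` becomes 1/(1 + E) for the resolvent, which vanishes on vectors orthogonal
to the domain. Truncations and Gibbs operators are functions of the resolvent, so this diagonalizes
them too. -/
theorem IsIncreasingEigenvalueSeq.exists_isEigenbasis {en : ℕ → ℝ}
    (h : H.IsIncreasingEigenvalueSeq en) :
    ∃ (κ : Set 𝓗) (t : HilbertBasis (ℕ ⊕ κ) ℂ 𝓗), H.IsEigenbasis en t ∧
      (∀ k, ∃ h : t (Sum.inl k) ∈ H.op.domain, H.op ⟨_, h⟩ = (en k : ℂ) • t (Sum.inl k)) ∧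
      ∀ (y : H.op.domain) (j : κ), inner ℂ (t (Sum.inr j)) (y : 𝓗) = 0 := by
  obtain ⟨-, τ, hτ, hH, hspan⟩ := h
  obtain ⟨κ, t, ht⟩ := hτ.exists_hilbertBasis_sum
  have hH' : ∀ k, ∃ h : t (Sum.inl k) ∈ H.op.domain,
      H.op ⟨_, h⟩ = (en k : ℂ) • t (Sum.inl k) := by
    simpa only [ht] using hH
  have hinr : ∀ (y : H.op.domain) (j : κ), inner ℂ (t (Sum.inr j)) (y : 𝓗) = 0 := by
    intro y j
    have hle : (Submodule.span ℂ (Set.range τ)).topologicalClosure ≤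
        (Submodule.span ℂ {t (Sum.inr j)})ᗮ := by
      refine Submodule.topologicalClosure_minimal _ ?_ (Submodule.isClosed_orthogonal _)
      rw [Submodule.span_le]
      rintro _ ⟨k, rfl⟩
      rw [SetLike.mem_coe, Submodule.mem_orthogonal_singleton_iff_inner_right, ← ht]
      exact t.orthonormal.2 (by simp)
    exact Submodule.mem_orthogonal_singleton_iff_inner_right.1 (hle (hspan y.2))
  have hnn : ∀ k, 0 ≤ en k := by
    intro k
    obtain ⟨h1, h2⟩ := hH' k
    have h3 := H.nonneg ⟨_, h1⟩
    rw [h2, inner_smul_right, inner_self_eq_norm_sq_to_K, t.orthonormal.1] at h3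
    simpa using h3
  refine ⟨κ, t, ⟨hnn, ?_⟩, hH', hinr⟩
  rintro (k | j)
  · obtain ⟨h1, h2⟩ := hH' k
    have h3 := H.resolvent_add ⟨_, h1⟩
    have h4 : ((1 + en k : ℝ) : ℂ) ≠ 0 := by
      have := hnn k
      exact_mod_cast (by positivity : (1 + en k) ≠ 0)
    have h5 : t (Sum.inl k) + (en k : ℂ) • t (Sum.inl k) =
        ((1 + en k : ℝ) : ℂ) • t (Sum.inl k) := by
      rw [Complex.ofReal_add, add_smul, Complex.ofReal_one, one_smul]
    rw [h2, h5, map_smul] at h3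
    rw [Sum.elim_inl, one_div, Complex.ofReal_inv, eq_inv_smul_iff₀ h4]
    exact h3
  · simp only [Sum.elim_inr, Complex.ofReal_zero, zero_smul]
    exact H.resolvent_eq_zero fun y => by rw [← inner_conj_symm, hinr y j, map_zero]

/-- Expansion in the eigenbasis shows that `en 0` is a lower bound of the energies of unit vectors,
hence at most their infimum. -/
theorem IsIncreasingEigenvalueSeq.zero_eq_zero {en : ℕ → ℝ}
    (h : H.IsIncreasingEigenvalueSeq en) (hz : H.ZeroGroundEnergy) : en 0 = 0 := by
  obtain ⟨κ, t, ht, hH, hinr⟩ := h.exists_isEigenbasis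
  refine le_antisymm (hz.2 ?_) (ht.nonneg 0)
  rintro _ ⟨φ, hφ, rfl⟩
  have h1 := t.hasSum_sq_norm_inner (φ : 𝓗)
  have h2 := Complex.hasSum_re (t.hasSum_inner_mul_inner (φ : 𝓗) (H.op φ))
  have h3 := hasSum_le (fun i => ?_) (h1.mul_left (en 0)) h2
  · simpa [hφ] using h3
  · rcases i with k | j
    · obtain ⟨h4, h5⟩ := hH k
      have h6 : inner ℂ (t (Sum.inl k)) (H.op φ) = en k * inner ℂ (t (Sum.inl k)) (φ : 𝓗) := by
        rw [← H.symmetric ⟨_, h4⟩ φ, h5, inner_smul_left, Complex.conj_ofReal]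
      rw [h6, ← inner_conj_symm (φ : 𝓗), mul_left_comm, ← Complex.normSq_eq_conj_mul_self,
        Complex.normSq_eq_norm_sq, ← Complex.ofReal_mul, Complex.ofReal_re]
      exact mul_le_mul_of_nonneg_right (h.1 (Nat.zero_le k)) (by positivity)
    · rw [← inner_conj_symm (φ : 𝓗), hinr φ j]
      simp

/-- Up to the factor e^β and a rescaling this is `expNegInvGlue`, which is smooth at 0. -/
theorem continuous_gibbs {β : ℝ} (hβ : 0 < β) :
    Continuous fun r : ℝ => if r ≤ 0 then 0 else Real.exp (-β * (1 / r - 1)) := by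
  have : (fun r : ℝ => if r ≤ 0 then 0 else Real.exp (-β * (1 / r - 1))) =
      fun r => Real.exp β * expNegInvGlue (r / β) := by
    ext r
    rw [expNegInvGlue]
    by_cases h : r ≤ 0
    · rw [if_pos h, if_pos (div_nonpos_of_nonpos_of_nonneg h hβ.le), mul_zero]
    · have : ¬ r / β ≤ 0 := not_le.2 (div_pos (not_le.1 h) hβ)
      rw [if_neg h, if_neg this, ← Real.exp_add]
      congr 1
      have : r ≠ 0 := by rintro rfl; exact h le_rfl
      field_simp
      ring
  rw [this]
  exact continuous_const.mul ((expNegInvGlue.contDiff (n := 0)).continuous.comp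
    (continuous_id.div_const β))

/-- For 0 < r ≤ 1/(n + 1) the value 1/r - 1 is at least n, so r can be replaced by max(r, 1/(n +
1)), which stays away from the singularity. -/
theorem continuous_truncation (n : ℕ) :
    Continuous fun r : ℝ => if r ≤ 0 then (n : ℝ) else min (1 / r - 1) n := by
  have hn : (0 : ℝ) < 1 / (n + 1) := by positivity
  have : (fun r : ℝ => if r ≤ 0 then (n : ℝ) else min (1 / r - 1) n) =
      fun r : ℝ => min (1 / (max r (1 / (n + 1))) - 1) n := by
    ext r
    rcases le_total r (1 / (n + 1)) with h | h
    · rw [max_eq_right h, one_div_one_div, add_sub_cancel_right, min_self]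
      split_ifs with h0
      · rfl
      · refine min_eq_right ?_
        have h1 := one_div_le_one_div_of_le (not_le.1 h0) h
        rw [one_div_one_div] at h1
        linarith
    · rw [max_eq_left h, if_neg (not_le.2 (hn.trans_le h))]
  rw [this]
  refine Continuous.min (Continuous.sub (Continuous.div continuous_const
    (continuous_id.max continuous_const) fun r => ?_) continuous_const) continuous_const
  exact (hn.trans_le (le_max_right _ _)).ne'

/-- On r ≥ δ the function e^{-(1/r - 1)} is bounded below by a positive constant, so the cut-off is
dominated by a multiple of e^{-H}. -/
theorem posTrace_cutOff_resolvent_ne_top (hG : H.GibbsCondition) {δ : ℝ} (hδ : 0 < δ) :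
    posTrace (cutOff H.resolvent δ) ≠ ∞ := by
  have hR := H.isPositive_resolvent
  have hsa := hR.isSelfAdjoint
  have hc := continuous_gibbs one_pos
  set g : ℝ → ℝ := fun r => if r ≤ 0 then 0 else Real.exp (-1 * (1 / r - 1)) with hg
  set C : ℝ := ‖H.resolvent‖ * ‖(1 : 𝓗 →L[ℂ] 𝓗)‖ * Real.exp (1 / δ) with hC
  have hcut : cutOff H.resolvent δ = cfc (fun x : ℝ => max (x - δ) 0) H.resolvent :=
    cutOff_eq_cfc hsa δ
  have hle : cutOff H.resolvent δ ≤ cfc (fun x => C * g x) H.resolvent := by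
    rw [hcut]
    refine cfc_mono (fun x hx => ?_) (by fun_prop) (by fun_prop)
    have hx1 : x ≤ ‖H.resolvent‖ * ‖(1 : 𝓗 →L[ℂ] 𝓗)‖ :=
      (le_abs_self x).trans (spectrum.norm_le_norm_mul_of_mem hx)
    have hg0 : 0 ≤ g x := by
      simp only [hg]; split_ifs <;> positivity
    rcases le_total x δ with h | h
    · rw [max_eq_right (by linarith)]
      positivity
    · have hx0 : 0 < x := hδ.trans_le h
      have h1 : 1 ≤ Real.exp (1 / δ) * g x := by
        simp only [hg]
        rw [if_neg (not_le.2 hx0), ← Real.exp_add]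
        refine Real.one_le_exp ?_
        have := one_div_le_one_div_of_le hδ h
        linarith
      calc max (x - δ) 0 ≤ x := max_le (by linarith) hx0.le
        _ ≤ ‖H.resolvent‖ * ‖(1 : 𝓗 →L[ℂ] 𝓗)‖ * 1 := by rwa [mul_one]
        _ ≤ ‖H.resolvent‖ * ‖(1 : 𝓗 →L[ℂ] 𝓗)‖ * (Real.exp (1 / δ) * g x) := by gcongr
        _ = C * g x := by rw [hC]; ring
  have hlt := hG 1 one_pos
  have h1 : posTrace (cfc (fun x => C * g x) H.resolvent) =
      ENNReal.ofReal C * posTrace (H.gibbsExp 1) := by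
    rw [cfc_const_mul C g H.resolvent hc.continuousOn]
    exact posTrace_smul (by positivity) _
  refine ne_top_of_le_ne_top (b := ENNReal.ofReal C * posTrace (H.gibbsExp 1))
    (ENNReal.mul_ne_top ENNReal.ofReal_ne_top hlt.ne) ?_
  rw [← h1]
  refine posTrace_mono fun x => ?_
  have h2 := ((ContinuousLinearMap.le_def _ _).1 hle).re_inner_nonneg_right x
  rw [sub_apply, inner_sub_right] at h2
  simpa using h2

theorem exists_isIncreasingEigenvalueSeq (hdim : ¬ FiniteDimensional ℂ H.op.domain)
    (hG : H.GibbsCondition) : ∃ en, H.IsIncreasingEigenvalueSeq en := by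
  have hinf : ¬ FiniteDimensional ℂ 𝓗 := fun h => hdim inferInstance
  have hR := H.isPositive_resolvent
  obtain ⟨r, hr, φ, hφ, hs⟩ := exists_isDecreasingEigenvalueSeq_of_cutOff hinf hR
    fun δ hδ => posTrace_cutOff_resolvent_ne_top hG hδ
  obtain ⟨κ, b, hb⟩ := IsDecreasingEigenvalueSeq.exists_isDiagonal ⟨hr, φ, hφ, hs⟩
  have hr0 : ∀ k, 0 ≤ r k := fun k => hb.nonneg hR (Sum.inl k)
  have hdom : ∀ (S : Submodule ℂ 𝓗), (∀ ψ, H.resolvent ψ ∈ S) → H.op.domain ≤ S := by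
    intro S hS y hy
    have := hS ((⟨y, hy⟩ : H.op.domain) + H.op ⟨y, hy⟩)
    rwa [H.resolvent_add] at this
  -- A zero eigenvalue would be followed only by zeros, making the range of the resolvent, which
  -- contains the domain of `H`, finite-dimensional.
  have hrpos : ∀ k, 0 < r k := by
    intro k
    refine lt_of_le_of_ne (hr0 k) fun hk => hdim ?_
    have hz : ∀ j, k ≤ j → r j = 0 := fun j hj => le_antisymm (hk ▸ hr hj) (hr0 j)
    have hle := hdom (Submodule.span ℂ (φ '' (Finset.range k : Set ℕ))) fun ψ => by
      have h1 : H.resolvent ψ = ∑ j ∈ Finset.range k, ((r j : ℂ) * inner ℂ (φ j) ψ) • φ j := by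
        refine (hs ψ).unique (hasSum_sum_of_ne_finset_zero fun j hj => ?_)
        rw [hz j (by simpa using hj)]
        simp
      rw [h1]
      exact Submodule.sum_mem _ fun j hj => Submodule.smul_mem _ _
        (Submodule.subset_span ⟨j, hj, rfl⟩)
    have : FiniteDimensional ℂ (Submodule.span ℂ (φ '' (Finset.range k : Set ℕ))) :=
      FiniteDimensional.span_of_finite ℂ (Set.toFinite _)
    exact Submodule.finiteDimensional_of_le hle
  have hRφ : ∀ k, H.resolvent (((1 / r k : ℝ) : ℂ) • φ k) = φ k := by
    intro k
    have h1 : H.resolvent (φ k) = (r k : ℂ) • φ k := by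
      classical
      refine (hs (φ k)).unique ?_
      convert! hasSum_ite_eq k ((r k : ℂ) • φ k) using 2 with j
      rw [orthonormal_iff_ite.1 hφ]
      by_cases hjk : j = k <;> simp [hjk]
    rw [map_smul, h1, smul_smul, ← Complex.ofReal_mul, one_div,
      inv_mul_cancel₀ (hrpos k).ne', Complex.ofReal_one, one_smul]
  refine ⟨fun k => 1 / r k - 1, fun m n h => ?_, φ, hφ, fun k => ?_, ?_⟩
  · have := one_div_le_one_div_of_le (hrpos n) (hr h)
    simpa using this
  · have hmem : φ k ∈ H.op.domain := by
      rw [← hRφ k]; exact H.resolvent_mem _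
    refine ⟨hmem, ?_⟩
    have h1 : ((1 / r k : ℝ) : ℂ) • φ k - (φ k + H.op ⟨φ k, hmem⟩) = 0 := by
      refine H.eq_zero_of_inner_eq_zero ?_ fun y => ?_
      · exact Submodule.sub_mem _ (Submodule.smul_mem _ _ (H.op.domain.le_topologicalClosure hmem))
          (H.addId_mem_closure ⟨φ k, hmem⟩)
      · rw [inner_sub_right, H.inner_resolvent_eq (((1 / r k : ℝ) : ℂ) • φ k) y]
        simp only [hRφ k, sub_self]
    rw [Complex.ofReal_sub, sub_smul, Complex.ofReal_one, one_smul]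
    rw [← sub_sub, sub_eq_zero] at h1
    exact h1.symm
  · refine hdom _ fun ψ => ?_
    refine (Submodule.isClosed_topologicalClosure _).mem_of_tendsto (hs ψ)
      (Filter.Eventually.of_forall fun s => Submodule.sum_mem _ fun j _ => Submodule.smul_mem _ _
        (Submodule.le_topologicalClosure _ (Submodule.subset_span ⟨j, rfl⟩)))

/-! ### Gibbs operators, truncations and energy in an eigenbasis -/

namespace IsEigenbasis

variable {κ : Type*} {en : ℕ → ℝ} {t : HilbertBasis (ℕ ⊕ κ) ℂ 𝓗}

theorem isDiagonal_gibbsExp (h : H.IsEigenbasis en t) {β : ℝ} (hβ : 0 < β) :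
    IsDiagonal t (Sum.elim (fun k => Real.exp (-β * en k)) fun _ => 0) (H.gibbsExp β) := by
  have := h.isDiagonal.cfc (continuous_gibbs hβ).continuousOn
  convert! this using 1
  ext (k | j)
  · have := h.nonneg k
    have h1 : ¬ 1 / (1 + en k) ≤ 0 := by rw [not_le]; positivity
    simp only [Sum.elim_inl, if_neg h1, one_div_one_div, add_sub_cancel_left]
  · simp

theorem summable_exp (h : H.IsEigenbasis en t) (hG : H.GibbsCondition) {β : ℝ} (hβ : 0 < β) :
    Summable fun k => Real.exp (-β * en k) := by
  have h1 := (hG β hβ).ne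
  rw [(h.isDiagonal_gibbsExp hβ).posTrace_elim fun k => (Real.exp_pos _).le] at h1
  have := ENNReal.summable_toReal h1
  simpa [ENNReal.toReal_ofReal, (Real.exp_pos _).le] using this

theorem isDiagonal_truncation (h : H.IsEigenbasis en t) (n : ℕ) :
    IsDiagonal t (Sum.elim (fun k => min (en k) n) fun _ => n) (H.truncation n) := by
  have := h.isDiagonal.cfc (continuous_truncation n).continuousOn
  convert! this using 1
  ext (k | j)
  · have := h.nonneg k
    have h1 : ¬ 1 / (1 + en k) ≤ 0 := by rw [not_le]; positivity
    simp only [Sum.elim_inl, if_neg h1, one_div_one_div, add_sub_cancel_left]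
  · simp

/-- The energy of a positive operator in an eigenbasis of `H`. -/
theorem energy_eq (h : H.IsEigenbasis en t) {A : 𝓗 →L[ℂ] 𝓗} (hA : A.IsPositive) :
    H.energy A = ∑' j, Sum.elim (fun k => ENNReal.ofReal (en k)) (fun _ => ∞) j *
      ENNReal.ofReal (inner ℂ (t j) (A (t j))).re := by
  have hsA : ContinuousLinearMap.adjoint (CFC.sqrt A) = CFC.sqrt A :=
    ((ContinuousLinearMap.nonneg_iff_isPositive _).1 (CFC.sqrt_nonneg A)).isSelfAdjoint
  let w : ℕ → ℕ ⊕ κ → ℝ := fun n => Sum.elim (fun k => min (en k) n) fun _ => n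
  have hw0 : ∀ n j, 0 ≤ w n j := by
    rintro n (k | j)
    · exact le_min (h.nonneg k) (Nat.cast_nonneg n)
    · exact Nat.cast_nonneg n
  have hwm : ∀ j, Monotone fun n => w n j := by
    rintro (k | j) m n hmn
    · exact min_le_min le_rfl (Nat.cast_le.2 hmn)
    · exact Nat.cast_le.2 hmn
  -- The operator is T*T with T = min(H, n)^{1/2} A^{1/2}, and its trace is ∑ ‖T* tⱼ‖², where T* tⱼ
  -- is √(w n j) √A tⱼ.
  have h1 : ∀ n, posTrace (CFC.sqrt A * H.truncation n * CFC.sqrt A) =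
      ∑' j, ENNReal.ofReal (w n j) * ENNReal.ofReal (inner ℂ (t j) (A (t j))).re := by
    intro n
    have hd := h.isDiagonal_truncation n
    have hp : 0 ≤ H.truncation n :=
      (ContinuousLinearMap.nonneg_iff_isPositive _).2 (hd.isPositive (hw0 n))
    have hsT : ContinuousLinearMap.adjoint (CFC.sqrt (H.truncation n)) =
        CFC.sqrt (H.truncation n) :=
      ((ContinuousLinearMap.nonneg_iff_isPositive _).1
        (CFC.sqrt_nonneg (H.truncation n))).isSelfAdjoint
    have hadj : ContinuousLinearMap.adjoint (CFC.sqrt (H.truncation n) * CFC.sqrt A) =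
        CFC.sqrt A * CFC.sqrt (H.truncation n) := by
      rw [← ContinuousLinearMap.star_eq_adjoint, star_mul, ContinuousLinearMap.star_eq_adjoint,
        ContinuousLinearMap.star_eq_adjoint, hsA, hsT]
    have h2 : CFC.sqrt A * H.truncation n * CFC.sqrt A =
        ContinuousLinearMap.adjoint (CFC.sqrt (H.truncation n) * CFC.sqrt A) *
          (CFC.sqrt (H.truncation n) * CFC.sqrt A) := by
      rw [hadj]
      conv_lhs => rw [← CFC.sqrt_mul_sqrt_self (H.truncation n) hp]
      simp only [mul_assoc]
    rw [h2, posTrace_adjoint_mul _ t, hadj]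
    refine tsum_congr fun j => ?_
    rw [mul_apply_eq_comp, hd.sqrt (hw0 n) j, map_smul, norm_smul, mul_pow,
      ← re_inner_eq_sq_norm_sqrt hA, Complex.norm_real, Real.norm_eq_abs, sq_abs,
      Real.sq_sqrt (hw0 n j), ENNReal.ofReal_mul (hw0 n j)]
  have h3 : ∀ j, Sum.elim (fun k => ENNReal.ofReal (en k)) (fun _ => ∞) j =
      ⨆ n, ENNReal.ofReal (w n j) := by
    rintro (k | j)
    · refine le_antisymm ?_ (iSup_le fun n => ENNReal.ofReal_le_ofReal (min_le_left _ _))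
      obtain ⟨n, hn⟩ := exists_nat_ge (en k)
      refine le_iSup_of_le n (ENNReal.ofReal_le_ofReal (le_min le_rfl hn))
    · simp [w, ENNReal.iSup_natCast]
  simp_rw [energy, h1, h3, ENNReal.iSup_mul]
  rw [ENNReal.tsum_eq_iSup_sum]
  -- Monotone convergence: the supremum over `n` passes through finite sums and then commutes with
  -- the supremum over finite sets.
  have h4 : ∀ s : Finset (ℕ ⊕ κ),
      ∑ j ∈ s, ⨆ n, ENNReal.ofReal (w n j) * ENNReal.ofReal (inner ℂ (t j) (A (t j))).re =
      ⨆ n, ∑ j ∈ s, ENNReal.ofReal (w n j) * ENNReal.ofReal (inner ℂ (t j) (A (t j))).re :=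
    fun s => ENNReal.finsetSum_iSup_of_monotone fun j m n hmn =>
      mul_le_mul_left (ENNReal.ofReal_le_ofReal (hwm j hmn)) _
  simp_rw [h4]
  rw [iSup_comm]
  simp_rw [ENNReal.tsum_eq_iSup_sum]

theorem energy_add (h : H.IsEigenbasis en t) {A B : 𝓗 →L[ℂ] 𝓗} (hA : A.IsPositive)
    (hB : B.IsPositive) : H.energy (A + B) = H.energy A + H.energy B := by
  rw [h.energy_eq hA, h.energy_eq hB, h.energy_eq (hA.add hB), ← ENNReal.tsum_add]
  refine tsum_congr fun j => ?_
  rw [add_apply, inner_add_right, Complex.add_re, ENNReal.ofReal_add, mul_add]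
  · exact hA.re_inner_nonneg_right _
  · exact hB.re_inner_nonneg_right _

theorem energy_smul (h : H.IsEigenbasis en t) {A : 𝓗 →L[ℂ] 𝓗} (hA : A.IsPositive) {c : ℝ}
    (hc : 0 ≤ c) : H.energy (c • A) = ENNReal.ofReal c * H.energy A := by
  have hcA : (c • A).IsPositive := by
    rw [← ContinuousLinearMap.nonneg_iff_isPositive] at hA ⊢
    exact smul_nonneg hc hA
  rw [h.energy_eq hA, h.energy_eq hcA, ← ENNReal.tsum_mul_left]
  refine tsum_congr fun j => ?_
  rw [smul_apply, inner_smul_right_eq_smul, Complex.smul_re, smul_eq_mul, ENNReal.ofReal_mul hc]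
  ring

end IsEigenbasis

end PositiveOperator

/-! ### Scalar inequalities for η and g -/

section RealInequalities

open Real

/-- This is ln x ≤ x - 1 at x = p/l. Keeping `l` and `p` lets it be summed over distributions
without subtraction. -/
theorem negMulLog_add_le {l p : ℝ} (hl : 0 ≤ l) (hp : 0 < p) :
    negMulLog l + l ≤ l * (-log p) + p := by
  rcases hl.eq_or_lt with rfl | hl
  · simp [hp.le]
  · have h := log_le_sub_one_of_pos (div_pos hp hl)
    rw [log_div hp.ne' hl.ne', le_sub_iff_add_le, le_div_iff₀ hl] at h
    rw [negMulLog]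
    linarith

theorem negMulLog_add_le_add {x y : ℝ} (hx : 0 ≤ x) (hy : 0 ≤ y) :
    negMulLog (x + y) ≤ negMulLog x + negMulLog y := by
  rcases hx.eq_or_lt with rfl | hx
  · simp
  rcases hy.eq_or_lt with rfl | hy
  · simp
  have h1 := log_le_log hx (le_add_of_nonneg_right hy.le)
  have h2 := log_le_log hy (le_add_of_nonneg_left hx.le)
  have h3 := mul_le_mul_of_nonneg_left h1 hx.le
  have h4 := mul_le_mul_of_nonneg_left h2 hy.le
  simp only [negMulLog]
  linarith

/-- Concavity of η at the points l and e/δ with weights 1/(1 + δ) and δ/(1 + δ), whose mean is (l +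
e)/(1 + δ). The term η(e/δ) is nonnegative, as e/δ ≤ 1, and is dropped. -/
theorem negMulLog_le_add_mul_log {l e δ : ℝ} (hl : 0 ≤ l) (he : 0 ≤ e) (hδ : 0 < δ)
    (heδ : e ≤ δ) : negMulLog l ≤ negMulLog (l + e) + (l + e) * log (1 + δ) := by
  have h1δ : 0 < 1 + δ := by positivity
  have hl' : l ∈ Set.Ici (0 : ℝ) := hl
  have he' : e / δ ∈ Set.Ici (0 : ℝ) := div_nonneg he hδ.le
  have ha : 0 ≤ (1 + δ)⁻¹ := by positivity
  have hb : 0 ≤ (1 + δ)⁻¹ * δ := by positivity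
  have hc := concaveOn_negMulLog.2 hl' he' ha hb (by field_simp)
  simp only [smul_eq_mul] at hc
  have h2 : (1 + δ)⁻¹ * l + (1 + δ)⁻¹ * δ * (e / δ) = (l + e) * (1 + δ)⁻¹ := by
    field_simp
  have h3 : 0 ≤ negMulLog (e / δ) :=
    negMulLog_nonneg (by positivity) ((div_le_one hδ).2 heδ)
  have h4 : negMulLog (1 + δ)⁻¹ = (1 + δ)⁻¹ * log (1 + δ) := by
    rw [negMulLog, log_inv]; ring
  rw [h2, negMulLog_mul, h4] at hc
  have h5 : (1 + δ)⁻¹ * negMulLog l ≤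
      (1 + δ)⁻¹ * (negMulLog (l + e) + (l + e) * log (1 + δ)) := by
    have : 0 ≤ (1 + δ)⁻¹ * δ * negMulLog (e / δ) := by positivity
    linarith
  exact le_of_mul_le_mul_left h5 (by positivity)

/-- The scalar core of the entropy bound. Summed over eigenvalues, d/δ has total 1 and l + e has
total 1 + δ, so the last two terms add up to η(δ) + (1 + δ) ln(1 + δ) = g(δ). -/
theorem negMulLog_le_of_add_eq_add {l m d e δ : ℝ} (hl : 0 ≤ l) (hm : 0 ≤ m) (hd : 0 ≤ d)
    (he : 0 ≤ e) (hδ : 0 < δ) (heδ : e ≤ δ) (h : l + e = m + d) :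
    negMulLog l ≤ negMulLog m + δ * negMulLog (d / δ) + d / δ * negMulLog δ +
      (l + e) * log (1 + δ) := by
  have h1 := negMulLog_le_add_mul_log hl he hδ heδ
  have h2 := negMulLog_add_le_add hm hd
  have h3 : negMulLog d = d / δ * negMulLog δ + δ * negMulLog (d / δ) := by
    rw [← negMulLog_mul, mul_div_cancel₀ _ hδ.ne']
  rw [← h] at h2
  linarith

theorem gFun_eq (x : ℝ) : gFun x = negMulLog x + (1 + x) * log (1 + x) := by
  rw [gFun, negMulLog, add_comm x 1]; ring

/-- The tangent at y lies above the concave g, that is, g(x) ≤ g(y) - (y - x)(ln(1 + y) - ln y), and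
its slope is nonnegative. -/
theorem gFun_mono {x y : ℝ} (hx : 0 < x) (hxy : x ≤ y) : gFun x ≤ gFun y := by
  have hy := hx.trans_le hxy
  have h1 := log_le_sub_one_of_pos (x := y * (1 + x) / (x * (1 + y))) (by positivity)
  have h2 := log_le_sub_one_of_pos (x := (1 + x) / (1 + y)) (by positivity)
  have h3 : x * (y * (1 + x) / (x * (1 + y)) - 1) + ((1 + x) / (1 + y) - 1) = 0 := by
    field_simp
    ring
  rw [log_div (by positivity) (by positivity), log_mul (by positivity) (by positivity),
    log_mul (by positivity) (by positivity)] at h1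
  rw [log_div (by positivity) (by positivity)] at h2
  have h4 := mul_le_mul_of_nonneg_left h1 hx.le
  have h5 : 0 ≤ (y - x) * (log (1 + y) - log y) :=
    mul_nonneg (by linarith) (by linarith [log_le_log hy (by linarith : y ≤ 1 + y)])
  simp only [gFun]
  rw [add_comm y 1, add_comm x 1]
  linarith

end RealInequalities

/-! ### Entropy of diagonal operators and of diagonal parts -/

section Entropy

variable {𝓗 : Type u} [NormedAddCommGroup 𝓗] [InnerProductSpace ℂ 𝓗] [CompleteSpace 𝓗]
  {ι : Type*} {b : HilbertBasis ι ℂ 𝓗} {a : ι → ℝ} {ρ : 𝓗 →L[ℂ] 𝓗}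

theorem le_one_of_tsum_ofReal_eq_one {α : Type*} {p : α → ℝ}
    (h : ∑' i, ENNReal.ofReal (p i) = 1) (i : α) : p i ≤ 1 := by
  rw [← ENNReal.ofReal_le_one, ← h]
  exact ENNReal.le_tsum i

theorem hasSum_of_tsum_ofReal_eq {α : Type*} {p : α → ℝ} (hp : ∀ i, 0 ≤ p i) {c : ℝ≥0}
    (h : ∑' i, ENNReal.ofReal (p i) = c) : HasSum p c := by
  have := ENNReal.hasSum_toReal (f := fun i => ENNReal.ofReal (p i)) (by rw [h]; simp)
  rw [← ENNReal.tsum_toReal_eq (by simp), h, ENNReal.coe_toReal] at this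
  simpa only [ENNReal.toReal_ofReal (hp _)] using this

theorem HasSum.tsum_ofReal {α : Type*} {p : α → ℝ} (hp : ∀ i, 0 ≤ p i) {c : ℝ}
    (h : HasSum p c) : ∑' i, ENNReal.ofReal (p i) = ENNReal.ofReal c := by
  rw [← h.tsum_eq, ENNReal.ofReal_tsum_of_nonneg hp h.summable]

theorem IsDiagonal.vonNeumannEntropy_eq (h : IsDiagonal b a ρ) (h0 : ∀ i, 0 ≤ a i)
    (h1 : ∀ i, a i ≤ 1) :
    vonNeumannEntropy ρ = ∑' i, ENNReal.ofReal (Real.negMulLog (a i)) :=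
  (h.cfc Real.continuous_negMulLog.continuousOn).posTrace_eq fun i =>
    Real.negMulLog_nonneg (h0 i) (h1 i)

theorem IsDiagonal.isState (h : IsDiagonal b a ρ) (h0 : ∀ i, 0 ≤ a i)
    (h1 : ∑' i, ENNReal.ofReal (a i) = 1) : IsState ρ :=
  ⟨h.isPositive h0, (h.posTrace_eq h0).trans h1⟩

theorem IsDiagonal.tsum_eq_one (h : IsDiagonal b a ρ) (hρ : IsState ρ) :
    ∑' i, ENNReal.ofReal (a i) = 1 := by
  rw [← h.posTrace_eq (h.nonneg hρ.1), hρ.2]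

theorem IsState.exists_isDiagonal (hρ : IsState ρ) :
    ∃ (ι : Type u) (b : HilbertBasis ι ℂ 𝓗) (a : ι → ℝ), IsDiagonal b a ρ := by
  obtain ⟨ι, b, a, -, h⟩ := exists_isDiagonal_of_isCompactOperator hρ.1
    (isCompactOperator_of_posTrace_ne_top hρ.1 (by rw [hρ.2]; exact ENNReal.one_ne_top))
  exact ⟨ι, b, a, h⟩

/-- Passing to the diagonal part in an orthonormal basis does not decrease the entropy. -/
theorem vonNeumannEntropy_le_diagonal {ι' : Type*} (t : HilbertBasis ι' ℂ 𝓗) (hρ : IsState ρ) :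
    vonNeumannEntropy ρ ≤
      ∑' j, ENNReal.ofReal (Real.negMulLog (inner ℂ (t j) (ρ (t j))).re) := by
  obtain ⟨ι, b, a, h⟩ := hρ.exists_isDiagonal
  set q : ι' → ℝ := fun j => (inner ℂ (t j) (ρ (t j))).re with hq
  have ha0 := h.nonneg hρ.1
  have hasum := h.tsum_eq_one hρ
  have ha1 := le_one_of_tsum_ofReal_eq_one hasum
  have hq0 : ∀ j, 0 ≤ q j := fun j => hρ.1.re_inner_nonneg_right (t j)
  have hqsum : ∑' j, ENNReal.ofReal (q j) = 1 := by rw [← posTrace_eq_tsum hρ.1 t, hρ.2]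
  have hq1 := le_one_of_tsum_ofReal_eq_one hqsum
  -- A doubly stochastic matrix carrying the eigenvalues `a` to the diagonal `q`.
  let D : ι → ι' → ℝ := fun i j => ‖inner ℂ (b i) (t j)‖ ^ 2
  have hD0 : ∀ i j, 0 ≤ D i j := fun i j => by positivity
  have hDq : ∀ j, HasSum (fun i => a i * D i j) (q j) := fun j => h.hasSum_re_inner (t j)
  have hDq' : ∀ j, ∑' i, ENNReal.ofReal (a i * D i j) = ENNReal.ofReal (q j) := fun j =>
    (hDq j).tsum_ofReal fun i => mul_nonneg (ha0 i) (hD0 i j)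
  have hD1 : ∀ j, ∑' i, ENNReal.ofReal (D i j) = 1 := fun j => by
    rw [b.tsum_ofReal_sq_norm_inner (t j), t.orthonormal.1 j, one_pow, ENNReal.ofReal_one]
  have hD2 : ∀ i, ∑' j, ENNReal.ofReal (D i j) = 1 := fun i => by
    simp only [D, norm_inner_symm (b i)]
    rw [t.tsum_ofReal_sq_norm_inner (b i), b.orthonormal.1 i, one_pow, ENNReal.ofReal_one]
  have hη0 : ∀ i, 0 ≤ Real.negMulLog (a i) := fun i => Real.negMulLog_nonneg (ha0 i) (ha1 i)
  have key : ∀ i j, ENNReal.ofReal (Real.negMulLog (a i) + a i) * ENNReal.ofReal (D i j) ≤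
      ENNReal.ofReal (-Real.log (q j)) * ENNReal.ofReal (a i * D i j) +
        ENNReal.ofReal (q j) * ENNReal.ofReal (D i j) := by
    intro i j
    have hlog : 0 ≤ -Real.log (q j) := neg_nonneg.2 (Real.log_nonpos (hq0 j) (hq1 j))
    rw [← ENNReal.ofReal_mul (add_nonneg (hη0 i) (ha0 i)), ← ENNReal.ofReal_mul hlog,
      ← ENNReal.ofReal_mul (hq0 j), ← ENNReal.ofReal_add
        (mul_nonneg hlog (mul_nonneg (ha0 i) (hD0 i j))) (mul_nonneg (hq0 j) (hD0 i j))]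
    refine ENNReal.ofReal_le_ofReal ?_
    -- If `q j = 0`, the logarithm has its default value 0, but then `a i * D i j = 0` as well.
    rcases (hq0 j).eq_or_lt with hqj | hqj
    · have h1 : a i * D i j = 0 := by
        have h2 := hDq j
        rw [← hqj] at h2
        exact congrFun
          ((hasSum_zero_iff_of_nonneg fun i => mul_nonneg (ha0 i) (hD0 i j)).1 h2) i
      rcases mul_eq_zero.1 h1 with h3 | h3
      · simp [h3, ← hqj]
      · simp [h3]
    · have h1 := mul_le_mul_of_nonneg_right (negMulLog_add_le (ha0 i) hqj) (hD0 i j)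
      linarith
  -- The 1 added on either side is the total mass of `a`, respectively `q`; all summands are then
  -- nonnegative.
  have h1 : vonNeumannEntropy ρ + 1 ≤ ∑' j, ENNReal.ofReal (Real.negMulLog (q j)) + 1 := by
    calc vonNeumannEntropy ρ + 1
        = ∑' i, ENNReal.ofReal (Real.negMulLog (a i) + a i) := by
          rw [h.vonNeumannEntropy_eq ha0 ha1, ← hasum, ← ENNReal.tsum_add]
          exact tsum_congr fun i => (ENNReal.ofReal_add (hη0 i) (ha0 i)).symm
      _ = ∑' i, ∑' j, ENNReal.ofReal (Real.negMulLog (a i) + a i) * ENNReal.ofReal (D i j) := by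
          refine tsum_congr fun i => ?_
          rw [ENNReal.tsum_mul_left, hD2, mul_one]
      _ ≤ ∑' i, ∑' j, (ENNReal.ofReal (-Real.log (q j)) * ENNReal.ofReal (a i * D i j) +
            ENNReal.ofReal (q j) * ENNReal.ofReal (D i j)) :=
          ENNReal.tsum_le_tsum fun i => ENNReal.tsum_le_tsum fun j => key i j
      _ = ∑' j, (ENNReal.ofReal (-Real.log (q j)) * ENNReal.ofReal (q j) +
            ENNReal.ofReal (q j)) := by
          rw [ENNReal.tsum_comm]
          refine tsum_congr fun j => ?_
          rw [ENNReal.tsum_add, ENNReal.tsum_mul_left, ENNReal.tsum_mul_left, hDq', hD1, mul_one]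
      _ = _ := by
          rw [ENNReal.tsum_add, hqsum]
          congr 1
          refine tsum_congr fun j => ?_
          rw [← ENNReal.ofReal_mul' (hq0 j), Real.negMulLog]
          congr 1
          ring
  exact (ENNReal.add_le_add_iff_right ENNReal.one_ne_top).1 h1

end Entropy

/-! ### Mixing a distribution with the ground level -/

section Mixture

/-- The mixture, with weights `s` and `1 - s`, of `p` and the point mass at `0`. -/
def mixZero (s : ℝ≥0) (p : ℕ → ℝ) (k : ℕ) : ℝ :=
  s * p k + (1 - s) * (if k = 0 then 1 else 0)

variable {s : ℝ≥0} (hs : s ≤ 1) {p : ℕ → ℝ} (hp : ∀ k, 0 ≤ p k)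

include hs

theorem one_sub_nonneg_of_le_one : (0 : ℝ) ≤ 1 - s := sub_nonneg.2 (by exact_mod_cast hs)

include hp

theorem mixZero_nonneg (k : ℕ) : 0 ≤ mixZero s p k := by
  have := hp k
  have := one_sub_nonneg_of_le_one hs
  rw [mixZero]
  split_ifs <;> positivity

theorem ofReal_mixZero (k : ℕ) : ENNReal.ofReal (mixZero s p k) =
    s * ENNReal.ofReal (p k) + if k = 0 then ENNReal.ofReal (1 - s) else 0 := by
  have h0 : 0 ≤ (1 - (s : ℝ)) * (if k = 0 then 1 else 0) := by
    split_ifs <;> simp [one_sub_nonneg_of_le_one hs]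
  rw [mixZero, ENNReal.ofReal_add (mul_nonneg s.coe_nonneg (hp k)) h0,
    ENNReal.ofReal_mul s.coe_nonneg, ENNReal.ofReal_coe_nnreal]
  split_ifs <;> simp

theorem tsum_mixZero (hp1 : ∑' k, ENNReal.ofReal (p k) = 1) :
    ∑' k, ENNReal.ofReal (mixZero s p k) = 1 := by
  simp_rw [ofReal_mixZero hs hp]
  rw [ENNReal.tsum_add, ENNReal.tsum_mul_left, hp1, tsum_ite_eq, mul_one,
    ← ENNReal.ofReal_coe_nnreal, ← ENNReal.ofReal_add s.coe_nonneg (one_sub_nonneg_of_le_one hs)]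
  simp

theorem tsum_mul_mixZero {en : ℕ → ℝ} (hen : en 0 = 0) :
    ∑' k, ENNReal.ofReal (en k) * ENNReal.ofReal (mixZero s p k) =
      s * ∑' k, ENNReal.ofReal (en k) * ENNReal.ofReal (p k) := by
  rw [← ENNReal.tsum_mul_left]
  refine tsum_congr fun k => ?_
  rw [ofReal_mixZero hs hp, mul_add]
  rcases eq_or_ne k 0 with rfl | hk
  · simp [hen]
  · simp only [if_neg hk, mul_zero, add_zero]; ring

/-- Concavity of η, which vanishes at the values 0 and 1 of the point mass. -/
theorem mul_negMulLog_le_mixZero (k : ℕ) : s * ENNReal.ofReal (Real.negMulLog (p k)) ≤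
    ENNReal.ofReal (Real.negMulLog (mixZero s p k)) := by
  rw [← ENNReal.ofReal_coe_nnreal, ← ENNReal.ofReal_mul s.coe_nonneg]
  refine ENNReal.ofReal_le_ofReal ?_
  have h5 : (if k = 0 then (1 : ℝ) else 0) ∈ Set.Ici (0 : ℝ) := by
    rw [Set.mem_Ici]; split_ifs <;> norm_num
  have h3 := Real.concaveOn_negMulLog.2 (Set.mem_Ici.2 (hp k)) h5 s.coe_nonneg
    (one_sub_nonneg_of_le_one hs) (by simp)
  have h4 : Real.negMulLog (if k = 0 then 1 else 0) = 0 := by split_ifs <;> simp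
  simpa [h4, mixZero] using h3

end Mixture

/-! ### Reduction of F_H to distributions on the energy levels -/

namespace PositiveOperator.IsEigenbasis

variable {𝓗 : Type u} [NormedAddCommGroup 𝓗] [InnerProductSpace ℂ 𝓗] [CompleteSpace 𝓗]
  {H : PositiveOperator 𝓗} {κ : Type*} {en : ℕ → ℝ} {t : HilbertBasis (ℕ ⊕ κ) ℂ 𝓗}

/-- A state of finite energy is dominated by a probability distribution on the energy levels. -/
theorem exists_distribution (h : H.IsEigenbasis en t) {ρ : 𝓗 →L[ℂ] 𝓗} (hρ : IsState ρ)
    (hE : H.energy ρ ≠ ∞) :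
    ∃ p : ℕ → ℝ, (∀ k, 0 ≤ p k) ∧ ∑' k, ENNReal.ofReal (p k) = 1 ∧
      ∑' k, ENNReal.ofReal (en k) * ENNReal.ofReal (p k) = H.energy ρ ∧
      vonNeumannEntropy ρ ≤ ∑' k, ENNReal.ofReal (Real.negMulLog (p k)) := by
  have h1 := h.energy_eq hρ.1
  rw [ENNReal.tsum_sum_type] at h1
  -- Off the domain the energy weight is ∞, so finite energy leaves no mass there.
  have hz : ∀ j : κ, ENNReal.ofReal (inner ℂ (t (Sum.inr j)) (ρ (t (Sum.inr j)))).re = 0 := by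
    intro j
    by_contra h0
    refine hE ?_
    rw [h1]
    refine WithTop.add_eq_top.2 (Or.inr (ENNReal.tsum_eq_top_of_eq_top ⟨j, ?_⟩))
    exact ENNReal.top_mul h0
  have hnn : ∀ j, 0 ≤ (inner ℂ (t j) (ρ (t j))).re := fun j => hρ.1.re_inner_nonneg_right _
  have hz' : ∀ j : κ, (inner ℂ (t (Sum.inr j)) (ρ (t (Sum.inr j)))).re = 0 := fun j =>
    le_antisymm (ENNReal.ofReal_eq_zero.1 (hz j)) (hnn _)
  refine ⟨fun k => (inner ℂ (t (Sum.inl k)) (ρ (t (Sum.inl k)))).re, fun k => hnn _, ?_, ?_, ?_⟩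
  · have h2 := posTrace_eq_tsum hρ.1 t
    rw [hρ.2, ENNReal.tsum_sum_type] at h2
    simpa [hz'] using h2.symm
  · simpa [hz'] using h1.symm
  · have h2 := vonNeumannEntropy_le_diagonal t hρ
    rw [ENNReal.tsum_sum_type] at h2
    simpa [hz'] using h2

theorem exists_state (h : H.IsEigenbasis en t) {p : ℕ → ℝ} (hp : ∀ k, 0 ≤ p k)
    (hp1 : ∑' k, ENNReal.ofReal (p k) = 1) :
    ∃ ρ : 𝓗 →L[ℂ] 𝓗, IsDiagonal t (Sum.elim p fun _ => 0) ρ ∧ IsState ρ ∧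
      H.energy ρ = ∑' k, ENNReal.ofReal (en k) * ENNReal.ofReal (p k) ∧
      vonNeumannEntropy ρ = ∑' k, ENNReal.ofReal (Real.negMulLog (p k)) := by
  have h0 : ∀ i : ℕ ⊕ κ, 0 ≤ Sum.elim p (fun _ => 0) i := by rintro (k | j) <;> simp [hp]
  have h1 : ∑' i : ℕ ⊕ κ, ENNReal.ofReal (Sum.elim p (fun _ => 0) i) = 1 := by
    rw [ENNReal.tsum_sum_type]; simpa using hp1
  obtain ⟨ρ, hρ⟩ := exists_isDiagonal t
    (hasSum_of_tsum_ofReal_eq (c := 1) h0 (by simpa using h1)).summable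
  refine ⟨ρ, hρ, hρ.isState h0 h1, ?_, ?_⟩
  · rw [h.energy_eq (hρ.isPositive h0), ENNReal.tsum_sum_type]
    simp [hρ.re_inner_basis]
  · rw [hρ.vonNeumannEntropy_eq h0 (le_one_of_tsum_ofReal_eq_one h1), ENNReal.tsum_sum_type]
    simp

theorem le_maxEntropy (h : H.IsEigenbasis en t) {p : ℕ → ℝ} (hp : ∀ k, 0 ≤ p k)
    (hp1 : ∑' k, ENNReal.ofReal (p k) = 1) {X : ℝ≥0∞}
    (hX : ∑' k, ENNReal.ofReal (en k) * ENNReal.ofReal (p k) ≤ X) :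
    ∑' k, ENNReal.ofReal (Real.negMulLog (p k)) ≤ H.maxEntropy X := by
  obtain ⟨ρ, -, hρ, hE, hS⟩ := h.exists_state hp hp1
  rw [← hS]
  exact le_iSup_of_le ⟨ρ, hρ, hE ▸ hX⟩ le_rfl

theorem maxEntropy_le (h : H.IsEigenbasis en t) {X C : ℝ≥0∞} (hX : X ≠ ∞)
    (hC : ∀ p : ℕ → ℝ, (∀ k, 0 ≤ p k) → ∑' k, ENNReal.ofReal (p k) = 1 →
      ∑' k, ENNReal.ofReal (en k) * ENNReal.ofReal (p k) ≤ X →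
      ∑' k, ENNReal.ofReal (Real.negMulLog (p k)) ≤ C) : H.maxEntropy X ≤ C := by
  refine iSup_le fun ⟨ρ, hρ, hE⟩ => ?_
  obtain ⟨p, hp, hp1, hpE, hS⟩ := h.exists_distribution hρ (ne_top_of_le_ne_top hX hE)
  exact hS.trans (hC p hp hp1 (hpE ▸ hE))

/-- Comparison with the weights e^{-Eₖ} gives η(pₖ) ≤ Eₖ pₖ + e^{-Eₖ}, with sum at most X + Tr
e^{-H}. -/
theorem maxEntropy_lt_top (h : H.IsEigenbasis en t) (hG : H.GibbsCondition) {X : ℝ≥0∞}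
    (hX : X ≠ ∞) : H.maxEntropy X < ∞ := by
  have hs := h.summable_exp hG one_pos
  refine (h.maxEntropy_le hX (C := X + ENNReal.ofReal (∑' k, Real.exp (-1 * en k)))
    fun p hp hp1 hpE => ?_).trans_lt
      (ENNReal.add_lt_top.2 ⟨hX.lt_top, ENNReal.ofReal_lt_top⟩)
  calc ∑' k, ENNReal.ofReal (Real.negMulLog (p k))
      ≤ ∑' k, (ENNReal.ofReal (en k) * ENNReal.ofReal (p k) +
          ENNReal.ofReal (Real.exp (-1 * en k))) := by
        refine ENNReal.tsum_le_tsum fun k => ?_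
        rw [← ENNReal.ofReal_mul (h.nonneg k), ← ENNReal.ofReal_add
          (mul_nonneg (h.nonneg k) (hp k)) (Real.exp_pos _).le]
        refine ENNReal.ofReal_le_ofReal ?_
        have := negMulLog_add_le (hp k) (Real.exp_pos (-1 * en k))
        rw [Real.log_exp] at this
        linarith [hp k]
    _ ≤ _ := by
        rw [ENNReal.tsum_add, ENNReal.ofReal_tsum_of_nonneg (fun _ => (Real.exp_pos _).le) hs]
        gcongr

/-- Mixing with the ground state, with weight s = δ/ε on τ, multiplies the energy by s and keeps at
least s times the entropy of the distribution dominating τ. -/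
theorem mul_entropy_le_mul_maxEntropy (h : H.IsEigenbasis en t) (hen : en 0 = 0) {δ ε : ℝ≥0}
    (hδ : 0 < δ) (hδε : δ ≤ ε) {X : ℝ≥0∞} (hX : X ≠ ∞) {τ : 𝓗 →L[ℂ] 𝓗} (hτ : IsState τ)
    (hE : H.energy τ ≤ X / δ) : δ * vonNeumannEntropy τ ≤ ε * H.maxEntropy (X / ε) := by
  have hε : 0 < ε := hδ.trans_le hδε
  obtain ⟨p, hp, hp1, hpE, hS⟩ := h.exists_distribution hτ (ne_top_of_le_ne_top
    (ENNReal.div_ne_top hX (by exact_mod_cast hδ.ne')) hE)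
  set s : ℝ≥0 := δ / ε with hs
  have hs1 : s ≤ 1 := div_le_one_of_le₀ hδε zero_le
  have hsε : (δ : ℝ≥0∞) = ε * s := by
    rw [← ENNReal.coe_mul, hs, mul_div_cancel₀ _ hε.ne']
  have hE' : ∑' k, ENNReal.ofReal (en k) * ENNReal.ofReal (mixZero s p k) ≤ X / ε := by
    rw [tsum_mul_mixZero hs1 hp hen, hpE]
    calc (s : ℝ≥0∞) * H.energy τ ≤ s * (X / δ) := by gcongr
      _ = X / ε := by
        rw [hs, ENNReal.coe_div hε.ne', div_eq_mul_inv, div_eq_mul_inv, div_eq_mul_inv]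
        rw [mul_comm X, ← mul_assoc, mul_right_comm (δ : ℝ≥0∞),
          ENNReal.mul_inv_cancel (by exact_mod_cast hδ.ne') ENNReal.coe_ne_top, one_mul, mul_comm]
  calc (δ : ℝ≥0∞) * vonNeumannEntropy τ
      ≤ δ * ∑' k, ENNReal.ofReal (Real.negMulLog (p k)) := by gcongr
    _ = ε * ∑' k, s * ENNReal.ofReal (Real.negMulLog (p k)) := by
        rw [ENNReal.tsum_mul_left, hsε, mul_assoc]
    _ ≤ ε * ∑' k, ENNReal.ofReal (Real.negMulLog (mixZero s p k)) := by
        gcongr with k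
        exact mul_negMulLog_le_mixZero hs1 hp k
    _ ≤ _ := by
        gcongr
        exact h.le_maxEntropy (mixZero_nonneg hs1 hp) (tsum_mixZero hs1 hp hp1) hE'

end PositiveOperator.IsEigenbasis

/-! ### Gibbs distributions of prescribed mean energy -/

section Gibbs

open Real

variable {en : ℕ → ℝ}

theorem eventually_le_of_summable_exp (hs : Summable fun k => exp (-1 * en k)) (M : ℝ) :
    ∀ᶠ k in Filter.atTop, M ≤ en k := by
  filter_upwards [hs.tendsto_atTop_zero.eventually (gt_mem_nhds (exp_pos (-M)))] with k hk
  have := exp_lt_exp.1 hk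
  linarith

/-- Half of the exponent absorbs the factor Eₖ, because x e^{-x} ≤ 1. -/
theorem summable_mul_exp (hnn : ∀ k, 0 ≤ en k)
    (hs : ∀ β : ℝ, 0 < β → Summable fun k => exp (-β * en k)) {β : ℝ} (hβ : 0 < β) :
    Summable fun k => en k * exp (-β * en k) := by
  refine Summable.of_nonneg_of_le (fun k => mul_nonneg (hnn k) (exp_pos _).le) (fun k => ?_)
    ((hs (β / 2) (half_pos hβ)).mul_left (2 / β))
  have h1 : β / 2 * en k ≤ exp (β / 2 * en k) := by linarith [add_one_le_exp (β / 2 * en k)]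
  have h2 : exp (-β * en k) = exp (-(β / 2) * en k) * exp (-(β / 2) * en k) := by
    rw [← exp_add]; ring_nf
  have h3 : exp (β / 2 * en k) * exp (-(β / 2) * en k) = 1 := by
    rw [← exp_add]; ring_nf; exact exp_zero
  have h4 : en k * exp (-(β / 2) * en k) ≤ 2 / β := by
    rw [le_div_iff₀ hβ]
    nlinarith [mul_le_mul_of_nonneg_right h1 (exp_pos (-(β / 2) * en k)).le]
  rw [h2, ← mul_assoc]
  exact mul_le_mul_of_nonneg_right h4 (exp_pos _).le

/-- Every positive mean energy is attained by a Gibbs distribution. -/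
theorem exists_gibbs_parameter (hnn : ∀ k, 0 ≤ en k) (h0 : en 0 = 0)
    (hs : ∀ β : ℝ, 0 < β → Summable fun k => exp (-β * en k)) {X : ℝ} (hX : 0 < X) :
    ∃ β, 0 < β ∧ HasSum (fun k => (en k - X) * exp (-β * en k)) 0 := by
  have hsum : ∀ β : ℝ, 0 < β → Summable fun k => (en k - X) * exp (-β * en k) := by
    intro β hβ
    simp_rw [sub_mul]
    exact (summable_mul_exp hnn hs hβ).sub ((hs β hβ).mul_left X)
  -- `G β` is the partition function times the excess of the Gibbs mean energy over `X`; the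
  -- intermediate value theorem gives a zero.
  let G : ℝ → ℝ := fun β => ∑' k, (en k - X) * exp (-β * en k)
  have hcont : ContinuousOn G (Set.Ioi 0) := by
    intro β₀ hβ₀
    have hβ₀' : 0 < β₀ / 2 := half_pos hβ₀
    have h1 : ContinuousOn G (Set.Ioi (β₀ / 2)) := by
      refine continuousOn_tsum (u := fun k => en k * exp (-(β₀ / 2) * en k) +
        X * exp (-(β₀ / 2) * en k)) (fun k => by fun_prop)
        ((summable_mul_exp hnn hs hβ₀').add ((hs _ hβ₀').mul_left X)) fun k β hβ => ?_
      rw [norm_mul, norm_of_nonneg (exp_pos _).le, ← add_mul]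
      refine mul_le_mul ?_ (exp_le_exp.2 ?_) (exp_pos _).le (add_nonneg (hnn k) hX.le)
      · rw [norm_eq_abs, abs_le]
        constructor <;> linarith [hnn k]
      · nlinarith [hnn k, Set.mem_Ioi.1 hβ]
    exact (h1.continuousAt (Ioi_mem_nhds (half_lt_self hβ₀))).continuousWithinAt
  obtain ⟨β₁, hβ₁, hG₁⟩ : ∃ β, 0 < β ∧ 0 ≤ G β := by
    -- At β = 0 a partial sum is already positive: the first `N` levels cost at most `N * X`, and
    -- each of the next `M > N * X` contributes at least 1. This persists for small β > 0, and the
    -- remaining terms are nonnegative.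
    obtain ⟨N, hN⟩ := Filter.eventually_atTop.1
      (eventually_le_of_summable_exp (by simpa using hs 1 one_pos) (X + 1))
    obtain ⟨M, hM⟩ := exists_nat_gt (N * X)
    have hfin : 0 < ∑ k ∈ Finset.range (N + M), (en k - X) * exp (-0 * en k) := by
      simp only [neg_zero, zero_mul, exp_zero, mul_one]
      rw [Finset.sum_range_add]
      have h1 : -(N * X) ≤ ∑ k ∈ Finset.range N, (en k - X) := by
        have := Finset.card_nsmul_le_sum (Finset.range N) (fun k => en k - X) (-X)
          fun k _ => by linarith [hnn k]
        simpa using this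
      have h2 : (M : ℝ) ≤ ∑ k ∈ Finset.range M, (en (N + k) - X) := by
        have := Finset.card_nsmul_le_sum (Finset.range M) (fun k => en (N + k) - X) 1
          fun k _ => by linarith [hN (N + k) (Nat.le_add_right N k)]
        simpa using this
      linarith
    have hc : Continuous fun β : ℝ => ∑ k ∈ Finset.range (N + M), (en k - X) * exp (-β * en k) := by
      fun_prop
    have h1 := (hc.tendsto 0).eventually (lt_mem_nhds hfin)
    have h2 : ∀ᶠ β : ℝ in nhdsWithin 0 (Set.Ioi 0),
        0 < ∑ k ∈ Finset.range (N + M), (en k - X) * exp (-β * en k) := nhdsWithin_le_nhds h1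
    obtain ⟨β, hβ, hβ0⟩ := (h2.and self_mem_nhdsWithin).exists
    refine ⟨β, hβ0, hβ.le.trans ((hsum β hβ0).sum_le_tsum _ fun k hk => ?_)⟩
    have : N ≤ k := by
      rw [Finset.mem_range, not_lt] at hk
      omega
    exact mul_nonneg (by linarith [hN k this]) (exp_pos _).le
  obtain ⟨β₂, hβ₂, hG₂⟩ : ∃ β, 0 < β ∧ G β ≤ 0 := by
    have hs1 := summable_mul_exp hnn hs one_pos
    set K := ∑' k, en k * exp (-1 * en k) with hK
    have hK0 : 0 ≤ K := tsum_nonneg fun k => mul_nonneg (hnn k) (exp_pos _).le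
    -- Chosen so that exp(cX) = 1 + K/X: damping by exp(-cX) brings the contribution of the levels
    -- above `X` below `X`, the deficit of the ground level.
    set c := log (1 + K / X) / X with hc
    have hc0 : 0 ≤ c := div_nonneg (log_nonneg (by linarith [div_nonneg hK0 hX.le])) hX.le
    have hcX : exp (-(c * X)) * K ≤ X := by
      rw [hc, div_mul_cancel₀ _ hX.ne', exp_neg, exp_log (by positivity), inv_mul_le_iff₀
        (by positivity), add_mul, div_mul_cancel₀ _ hX.ne']
      linarith
    refine ⟨1 + c, by positivity, ?_⟩
    have h1 : HasSum (fun k => (if k = 0 then -X else 0) +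
        exp (-(c * X)) * (en k * exp (-1 * en k))) (-X + exp (-(c * X)) * K) :=
      (hasSum_ite_eq 0 (-X)).add (hs1.hasSum.mul_left _)
    refine (hasSum_le (fun k => ?_) (hsum (1 + c) (by positivity)).hasSum h1).trans (by linarith)
    rcases eq_or_ne k 0 with rfl | hk
    · simp [h0]
    · rw [if_neg hk, zero_add]
      rcases le_total (en k) X with h | h
      · exact (mul_nonpos_of_nonpos_of_nonneg (by linarith) (exp_pos _).le).trans
          (mul_nonneg (exp_pos _).le (mul_nonneg (hnn k) (exp_pos _).le))
      · have h2 : exp (-(1 + c) * en k) ≤ exp (-(c * X)) * exp (-1 * en k) := by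
          rw [← exp_add, exp_le_exp]
          nlinarith
        calc (en k - X) * exp (-(1 + c) * en k)
            ≤ en k * (exp (-(c * X)) * exp (-1 * en k)) :=
              mul_le_mul (by linarith) h2 (exp_pos _).le (hnn k)
          _ = _ := by ring
  obtain ⟨β, hβ, hGβ⟩ := isPreconnected_Ioi.intermediate_value hβ₂ hβ₁ hcont ⟨hG₂, hG₁⟩
  exact ⟨β, hβ, hGβ ▸ (hsum β hβ).hasSum⟩

end Gibbs

/-! ### The entropy maximizer and the rearrangement inequality -/

namespace PositiveOperator.IsEigenbasis

variable {𝓗 : Type u} [NormedAddCommGroup 𝓗] [InnerProductSpace ℂ 𝓗] [CompleteSpace 𝓗]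
  {H : PositiveOperator 𝓗} {κ : Type*} {en : ℕ → ℝ} {t : HilbertBasis (ℕ ⊕ κ) ℂ 𝓗}

/-- The Gibbs distribution maximizes the entropy among the distributions of given energy. -/
theorem exists_maximizer (h : H.IsEigenbasis en t) (hen : en 0 = 0) (hG : H.GibbsCondition)
    {X : ℝ≥0} (hX : 0 < X) :
    ∃ p : ℕ → ℝ, (∀ k, 0 < p k) ∧ ∑' k, ENNReal.ofReal (p k) = 1 ∧
      ∑' k, ENNReal.ofReal (en k) * ENNReal.ofReal (p k) ≤ X ∧
      H.maxEntropy X ≤ ∑' k, ENNReal.ofReal (Real.negMulLog (p k)) := by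
  obtain ⟨β, hβ, hβX⟩ := exists_gibbs_parameter h.nonneg hen (fun β hβ => h.summable_exp hG hβ)
    (X := X) hX
  have hs := h.summable_exp hG hβ
  set Z : ℝ := ∑' k, Real.exp (-β * en k) with hZ
  have hZ1 : 1 ≤ Z := by
    have := hs.le_tsum 0 fun k _ => (Real.exp_pos _).le
    rwa [hen, mul_zero, Real.exp_zero] at this
  have hZ0 : 0 < Z := by linarith
  have hlogZ : 0 ≤ Real.log Z := Real.log_nonneg hZ1
  let q : ℕ → ℝ := fun k => Real.exp (-β * en k) / Z
  have hq : ∀ k, 0 < q k := fun k => by positivity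
  have hqsum : HasSum q 1 := by
    have := hs.hasSum.div_const Z
    rwa [← hZ, div_self hZ0.ne'] at this
  have hqE : HasSum (fun k => en k * q k) X := by
    have h1 := (hβX.div_const Z).add (hqsum.mul_left (X : ℝ))
    convert! h1 using 1
    · ext k
      simp only [q]
      ring
    · simp
  have hlogq : ∀ k, -Real.log (q k) = β * en k + Real.log Z := by
    intro k
    rw [Real.log_div (Real.exp_pos _).ne' hZ0.ne', Real.log_exp]
    ring
  have hqS : HasSum (fun k => Real.negMulLog (q k)) (β * X + Real.log Z) := by
    have h1 := (hqE.mul_left β).add (hqsum.mul_left (Real.log Z))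
    convert! h1 using 1
    · ext k
      have h2 := hlogq k
      rw [Real.negMulLog, neg_mul, ← mul_neg, h2]
      ring
    · ring
  have hq1 : ∑' k, ENNReal.ofReal (q k) = 1 := by
    rw [hqsum.tsum_ofReal fun k => (hq k).le, ENNReal.ofReal_one]
  refine ⟨q, hq, hq1, ?_, h.maxEntropy_le ENNReal.coe_ne_top fun p hp hp1 hpE => ?_⟩
  · simp_rw [← ENNReal.ofReal_mul (h.nonneg _)]
    rw [hqE.tsum_ofReal fun k => mul_nonneg (h.nonneg k) (hq k).le, ENNReal.ofReal_coe_nnreal]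
  · rw [hqS.tsum_ofReal fun k => Real.negMulLog_nonneg (hq k).le
      (le_one_of_tsum_ofReal_eq_one hq1 k)]
    have hp1' := le_one_of_tsum_ofReal_eq_one hp1
    -- Gibbs' inequality against `q`: -ln q is affine in the energy, so the cross-entropy depends on
    -- `p` only through its energy and is at most βX + ln Z, the entropy of `q`.
    refine (ENNReal.add_le_add_iff_right ENNReal.one_ne_top).1 ?_
    calc ∑' k, ENNReal.ofReal (Real.negMulLog (p k)) + 1
        = ∑' k, ENNReal.ofReal (Real.negMulLog (p k) + p k) := by
          rw [← hp1, ← ENNReal.tsum_add]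
          exact tsum_congr fun k =>
            (ENNReal.ofReal_add (Real.negMulLog_nonneg (hp k) (hp1' k)) (hp k)).symm
      _ ≤ ∑' k, (ENNReal.ofReal β * (ENNReal.ofReal (en k) * ENNReal.ofReal (p k)) +
            ENNReal.ofReal (Real.log Z) * ENNReal.ofReal (p k) + ENNReal.ofReal (q k)) := by
          refine ENNReal.tsum_le_tsum fun k => ?_
          have hk := h.nonneg k
          have hpk := hp k
          rw [← ENNReal.ofReal_mul hk, ← ENNReal.ofReal_mul hβ.le, ← ENNReal.ofReal_mul hlogZ,
            ← ENNReal.ofReal_add (by positivity) (by positivity),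
            ← ENNReal.ofReal_add (by positivity) (hq k).le]
          refine ENNReal.ofReal_le_ofReal ?_
          have := negMulLog_add_le hpk (hq k)
          rw [hlogq] at this
          linarith
      _ ≤ ENNReal.ofReal β * X + ENNReal.ofReal (Real.log Z) + 1 := by
          rw [ENNReal.tsum_add, ENNReal.tsum_add, ENNReal.tsum_mul_left, ENNReal.tsum_mul_left,
            hp1, hq1, mul_one]
          gcongr
      _ = _ := by
          rw [← ENNReal.ofReal_coe_nnreal, ← ENNReal.ofReal_mul hβ.le,
            ← ENNReal.ofReal_add (by positivity) hlogZ]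

/-- Among all operators with given eigenvalues, the energy is minimal for the operator which is
diagonal in the eigenbasis of `H`, with eigenvalues in opposite order. -/
theorem tsum_mul_eigenvalue_le_energy (h : H.IsEigenbasis en t) (hen : Monotone en)
    {κ' : Type*} {b : HilbertBasis (ℕ ⊕ κ') ℂ 𝓗} {a : ℕ → ℝ} {A : 𝓗 →L[ℂ] 𝓗}
    (hA : IsDiagonal b (Sum.elim a fun _ => 0) A) (ha : ∀ k, 0 ≤ a k) (hanti : Antitone a) : ∑' k, ENNReal.ofReal (en k * a k) ≤ H.energy A := by
  have ha0 : ∀ i, 0 ≤ Sum.elim a (fun _ : κ' => 0) i := by rintro (k | j) <;> simp [ha]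
  have hAp := hA.isPositive ha0
  let α : ℕ → ℝ≥0∞ := fun k => ENNReal.ofReal (a k)
  let q : ℕ ⊕ κ → ℝ≥0∞ := fun j => ENNReal.ofReal (inner ℂ (t j) (A (t j))).re
  let D : ℕ → ℕ → ℝ≥0∞ := fun i j =>
    ENNReal.ofReal (‖inner ℂ (b (Sum.inl i)) (t (Sum.inl j))‖ ^ 2)
  have hα : Antitone α := fun m n hmn => ENNReal.ofReal_le_ofReal (hanti hmn)
  have hq : ∀ k, q (Sum.inl k) = ∑' i, α i * D i k := by
    intro k
    have h1 := (hA.hasSum_re_inner (t (Sum.inl k))).tsum_ofReal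
      fun i => mul_nonneg (ha0 i) (by positivity)
    rw [ENNReal.tsum_sum_type] at h1
    simp only [Sum.elim_inl, Sum.elim_inr, zero_mul, ENNReal.ofReal_zero, tsum_zero,
      add_zero] at h1
    simp only [q, ← h1, α, D]
    exact tsum_congr fun i => ENNReal.ofReal_mul (ha i)
  have hD1 : ∀ k, ∑' i, D i k ≤ 1 := by
    intro k
    have h1 := b.tsum_ofReal_sq_norm_inner (t (Sum.inl k))
    rw [ENNReal.tsum_sum_type, t.orthonormal.1, one_pow, ENNReal.ofReal_one] at h1
    exact le_of_le_of_eq le_self_add h1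
  have hD2 : ∀ i, ∑' k, D i k ≤ 1 := by
    intro i
    have h1 := t.tsum_ofReal_sq_norm_inner (b (Sum.inl i))
    rw [ENNReal.tsum_sum_type, b.orthonormal.1, one_pow, ENNReal.ofReal_one] at h1
    simp only [D, norm_inner_symm (b _)]
    exact le_of_le_of_eq le_self_add h1
  have htot : ∑' k, α k = ∑' j, q j := by
    rw [← hA.posTrace_elim ha, posTrace_eq_tsum hAp t]
  -- The weights `s i` lie in [0, 1] with sum at most `m`, so ∑ αᵢ sᵢ is at most the sum of the
  -- first `m` of the decreasing αᵢ.
  have hKyFan : ∀ m, ∑ k ∈ Finset.range m, q (Sum.inl k) ≤ ∑ k ∈ Finset.range m, α k := by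
    intro m
    let s : ℕ → ℝ≥0∞ := fun i => ∑ k ∈ Finset.range m, D i k
    have hs1 : ∀ i, s i ≤ 1 := fun i => (ENNReal.sum_le_tsum _).trans (hD2 i)
    have hs2 : ∑' i, s i ≤ m := by
      simp only [s]
      rw [Summable.tsum_finsetSum fun _ _ => ENNReal.summable]
      refine (Finset.sum_le_sum fun k _ => hD1 k).trans ?_
      simp
    calc ∑ k ∈ Finset.range m, q (Sum.inl k) = ∑' i, α i * s i := by
          simp only [hq, s, Finset.mul_sum]
          rw [Summable.tsum_finsetSum fun _ _ => ENNReal.summable]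
      _ ≤ ∑' i, (α m * s i + if i ∈ Finset.range m then α i - α m else 0) := by
          refine ENNReal.tsum_le_tsum fun i => ?_
          split_ifs with hi
          · have hle : α m ≤ α i := hα (Finset.mem_range.1 hi).le
            calc α i * s i = α m * s i + (α i - α m) * s i := by
                  rw [← add_mul, add_tsub_cancel_of_le hle]
              _ ≤ α m * s i + (α i - α m) * 1 := by gcongr; exact hs1 i
              _ = _ := by rw [mul_one]
          · rw [add_zero]
            gcongr
            exact hα (by simpa using hi)
      _ ≤ α m * m + ∑ i ∈ Finset.range m, (α i - α m) := by
          rw [ENNReal.tsum_add, ENNReal.tsum_mul_left]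
          gcongr
          rw [tsum_eq_sum (s := Finset.range m) fun i hi => if_neg hi]
          exact le_of_eq (Finset.sum_congr rfl fun i hi => if_pos hi)
      _ = ∑ i ∈ Finset.range m, (α m + (α i - α m)) := by
          rw [Finset.sum_add_distrib, Finset.sum_const, Finset.card_range, nsmul_eq_mul,
            mul_comm]
      _ = _ := Finset.sum_congr rfl fun i hi =>
          add_tsub_cancel_of_le (hα (Finset.mem_range.1 hi).le)
  let up : ℕ → ℕ ⊕ κ → ℝ≥0∞ := fun m => Sum.elim (fun k => if m ≤ k then 1 else 0) fun _ => 1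
  -- Equality of traces turns the upper bound on heads into a lower bound on tails. The heads are
  -- finite and can be cancelled even if the trace is infinite.
  have htail : ∀ m, ∑' k, (if m ≤ k then 1 else 0) * α k ≤ ∑' j, up m j * q j := by
    intro m
    have hsplit : ∀ f : ℕ → ℝ≥0∞, ∑' k, f k =
        ∑ k ∈ Finset.range m, f k + ∑' k, (if m ≤ k then 1 else 0) * f k := by
      intro f
      have h1 : ∀ k, f k = (if k ∈ Finset.range m then f k else 0) +
          (if m ≤ k then 1 else 0) * f k := by
        intro k
        by_cases hk : m ≤ k
        · simp [hk, not_lt.2 hk]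
        · simp [hk, not_le.1 hk]
      rw [tsum_congr h1, ENNReal.tsum_add]
      congr 1
      rw [tsum_eq_sum (s := Finset.range m) fun i hi => if_neg hi]
      exact Finset.sum_congr rfl fun i hi => if_pos hi
    have hne : ∑ k ∈ Finset.range m, q (Sum.inl k) ≠ ∞ := by
      simp [q]
    refine (ENNReal.add_le_add_iff_left hne).1 ?_
    calc ∑ k ∈ Finset.range m, q (Sum.inl k) + ∑' k, (if m ≤ k then 1 else 0) * α k
        ≤ ∑ k ∈ Finset.range m, α k + ∑' k, (if m ≤ k then 1 else 0) * α k := by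
          gcongr ?_ + _
          exact hKyFan m
      _ = ∑' j, q j := by rw [← hsplit α, htot]
      _ = _ := by
          rw [ENNReal.tsum_sum_type, hsplit fun k => q (Sum.inl k), ENNReal.tsum_sum_type,
            add_assoc]
          simp [up]
  -- Abel summation: the increments of `en` are nonnegative, so the tail inequalities can be added
  -- with these weights.
  let Δ : ℕ → ℝ≥0∞ := fun m => ENNReal.ofReal (if m = 0 then en 0 else en m - en (m - 1))
  have hΔ : ∀ k, ENNReal.ofReal (en k) = ∑' m, Δ m * (if m ≤ k then 1 else 0) := by
    intro k
    rw [tsum_eq_sum (s := Finset.range (k + 1)) fun m hm => by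
      have : ¬ m ≤ k := by simpa [Nat.lt_succ_iff] using hm
      simp [this]]
    rw [Finset.sum_congr rfl fun m hm => by
      rw [if_pos (Nat.lt_succ_iff.1 (Finset.mem_range.1 hm)), mul_one]]
    induction k with
    | zero => simp [Δ]
    | succ k ih =>
      rw [Finset.sum_range_succ, ← ih]
      simp only [Nat.succ_ne_zero, if_false, Nat.add_sub_cancel]
      rw [← ENNReal.ofReal_add (h.nonneg k) (sub_nonneg.2 (hen (Nat.le_succ k)))]
      congr 1
      ring
  calc ∑' k, ENNReal.ofReal (en k * a k)
      = ∑' k, ∑' m, Δ m * ((if m ≤ k then 1 else 0) * α k) := by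
        refine tsum_congr fun k => ?_
        rw [ENNReal.ofReal_mul (h.nonneg k), hΔ k, ← ENNReal.tsum_mul_right]
        exact tsum_congr fun m => mul_assoc _ _ _
    _ = ∑' m, Δ m * ∑' k, (if m ≤ k then 1 else 0) * α k := by
        rw [ENNReal.tsum_comm]
        exact tsum_congr fun m => ENNReal.tsum_mul_left
    _ ≤ ∑' m, Δ m * ∑' j, up m j * q j := by
        gcongr with m
        exact htail m
    _ = ∑' j, (∑' m, Δ m * up m j) * q j := by
        simp_rw [← ENNReal.tsum_mul_left, ← ENNReal.tsum_mul_right]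
        rw [ENNReal.tsum_comm]
        simp only [mul_assoc]
    _ ≤ H.energy A := by
        rw [h.energy_eq hAp]
        refine ENNReal.tsum_le_tsum fun j => ?_
        refine mul_le_mul_left ?_ _
        rcases j with k | j
        · exact (hΔ k).ge
        · exact le_top

end PositiveOperator.IsEigenbasis

/-! ### The semicontinuity bound and its near-optimality -/

namespace PositiveOperator.IsEigenbasis

variable {𝓗 : Type u} [NormedAddCommGroup 𝓗] [InnerProductSpace ℂ 𝓗] [CompleteSpace 𝓗]
  {H : PositiveOperator 𝓗} {κ : Type*} {en : ℕ → ℝ} {t : HilbertBasis (ℕ ⊕ κ) ℂ 𝓗}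

theorem energy_mono (h : H.IsEigenbasis en t) {A B : 𝓗 →L[ℂ] 𝓗} (hA : A.IsPositive)
    (hAB : (B - A).IsPositive) : H.energy A ≤ H.energy B := by
  have := h.energy_add hA hAB
  rw [add_sub_cancel] at this
  rw [this]
  exact le_self_add

theorem energy_cutOff_le (h : H.IsEigenbasis en t) {ρ : 𝓗 →L[ℂ] 𝓗} (hρ : IsState ρ) {ε : ℝ}
    (hε : 0 ≤ ε) : H.energy (cutOff ρ ε) ≤ H.energy ρ := by
  obtain ⟨ι, b, a, hb⟩ := hρ.exists_isDiagonal
  refine h.energy_mono (cutOff_nonneg ρ ε) ((hb.sub (hb.cutOff ε)).isPositive fun i => ?_)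
  exact sub_nonneg.2 (max_le (by linarith) (hb.nonneg hρ.1 i))

/-- The semicontinuity bound for the entropy. -/
theorem entropy_le_entropy_add (h : H.IsEigenbasis en t) (hen : en 0 = 0) {E ε : ℝ≥0}
    {ρ σ : 𝓗 →L[ℂ] 𝓗} (hρ : IsState ρ) (hE : H.energy ρ ≤ E) (hσ : IsState σ)
    (hρσ : traceNorm (ρ - σ) / 2 ≤ ε) {lam : ℕ → ℝ} (hlam : IsDecreasingEigenvalueSeq ρ lam) :
    vonNeumannEntropy ρ ≤ vonNeumannEntropy σ +
      (ε * H.maxEntropy ((E - H.energy (cutOff ρ ε)) / ε) + ENNReal.ofReal (gFun ε)) := by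
  obtain ⟨κ₁, b, hb⟩ := hlam.exists_isDiagonal
  have hinf : ¬ FiniteDimensional ℂ 𝓗 := fun hfd =>
    not_finite_iff_infinite.2 inferInstance
      ((t.orthonormal.linearIndependent.finite : Finite (ℕ ⊕ κ)))
  obtain ⟨mu, hmu⟩ := exists_isDecreasingEigenvalueSeq hinf hσ.1
    (by rw [hσ.2]; exact ENNReal.one_ne_top)
  obtain ⟨κ₂, c, hc⟩ := hmu.exists_isDiagonal
  have hMirsky := tsum_abs_eigenvalue_sub_le_traceNorm hρ.1 hσ.1
    (by rw [hρ.2]; exact ENNReal.one_ne_top) (by rw [hσ.2]; exact ENNReal.one_ne_top)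
    hb hc hlam.1 hmu.1
  have hl0 : ∀ k, 0 ≤ lam k := fun k => hb.nonneg hρ.1 (Sum.inl k)
  have hm0 : ∀ k, 0 ≤ mu k := fun k => hc.nonneg hσ.1 (Sum.inl k)
  have hlsum : ∑' k, ENNReal.ofReal (lam k) = 1 := by rw [← hb.posTrace_elim hl0, hρ.2]
  have hmsum : ∑' k, ENNReal.ofReal (mu k) = 1 := by rw [← hc.posTrace_elim hm0, hσ.2]
  have hl1 := le_one_of_tsum_ofReal_eq_one hlsum
  have hm1 := le_one_of_tsum_ofReal_eq_one hmsum
  have hlS : HasSum lam 1 := by simpa using hasSum_of_tsum_ofReal_eq (c := 1) hl0 (by simpa)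
  have hmS : HasSum mu 1 := by simpa using hasSum_of_tsum_ofReal_eq (c := 1) hm0 (by simpa)
  have hSρ : vonNeumannEntropy ρ = ∑' k, ENNReal.ofReal (Real.negMulLog (lam k)) := by
    rw [hb.vonNeumannEntropy_eq (hb.nonneg hρ.1)
      (le_one_of_tsum_ofReal_eq_one (hb.tsum_eq_one hρ)), ENNReal.tsum_sum_type]
    simp
  have hSσ : vonNeumannEntropy σ = ∑' k, ENNReal.ofReal (Real.negMulLog (mu k)) := by
    rw [hc.vonNeumannEntropy_eq (hc.nonneg hσ.1)
      (le_one_of_tsum_ofReal_eq_one (hc.tsum_eq_one hσ)), ENNReal.tsum_sum_type]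
    simp
  let d : ℕ → ℝ := fun k => max (lam k - mu k) 0
  let e : ℕ → ℝ := fun k => max (mu k - lam k) 0
  have hd0 : ∀ k, 0 ≤ d k := fun k => le_max_right _ _
  have he0 : ∀ k, 0 ≤ e k := fun k => le_max_right _ _
  have hdl : ∀ k, d k ≤ lam k := fun k => max_le (by linarith [hm0 k]) (hl0 k)
  have hem : ∀ k, e k ≤ mu k := fun k => max_le (by linarith [hl0 k]) (hm0 k)
  have hle : ∀ k, lam k + e k = mu k + d k := by
    intro k
    simp only [d, e]
    rcases le_total (lam k) (mu k) with h | h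
    · rw [max_eq_left (by linarith), max_eq_right (by linarith)]; ring
    · rw [max_eq_right (by linarith), max_eq_left (by linarith)]; ring
  have habs : ∀ k, |lam k - mu k| = d k + e k := by
    intro k
    simp only [d, e]
    rcases le_total (lam k) (mu k) with h | h
    · rw [max_eq_right (by linarith), max_eq_left (by linarith), abs_of_nonpos (by linarith)]
      ring
    · rw [max_eq_left (by linarith), max_eq_right (by linarith), abs_of_nonneg (by linarith)]
      ring
  have hdsum : Summable d := Summable.of_nonneg_of_le hd0 hdl hlS.summable
  have hesum : Summable e := Summable.of_nonneg_of_le he0 hem hmS.summable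
  obtain ⟨δ, hδ⟩ : ∃ δ : ℝ≥0, (δ : ℝ) = ∑' k, d k := ⟨⟨_, tsum_nonneg hd0⟩, rfl⟩
  have hdS : HasSum d δ := hδ ▸ hdsum.hasSum
  -- Both parts have the same sum because both traces are 1.
  have heS : HasSum e δ := by
    have h1 := (hmS.add hdS).sub hlS
    convert! h1 using 1
    · ext k
      linarith [hle k]
    · ring
  have hδε : δ ≤ ε := by
    simp_rw [habs] at hMirsky
    rw [(hdS.add heS).tsum_ofReal fun k => add_nonneg (hd0 k) (he0 k),
      ENNReal.ofReal_add δ.coe_nonneg δ.coe_nonneg, ENNReal.ofReal_coe_nnreal, ← mul_two] at hMirsky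
    have h1 : (δ : ℝ≥0∞) ≤ ε := by
      refine le_trans ?_ hρσ
      rw [ENNReal.le_div_iff_mul_le (by simp) (by simp)]
      exact hMirsky
    exact_mod_cast h1
  have hdδ : ∀ k, d k ≤ δ := fun k => le_hasSum hdS k fun j _ => hd0 j
  have heδ : ∀ k, e k ≤ δ := fun k => le_hasSum heS k fun j _ => he0 j
  -- For δ = 0 the eigenvalues coincide and d/δ is no distribution.
  rcases eq_zero_or_pos δ with hδ0 | hδ0
  · have h1 : ∀ k, lam k = mu k := by
      intro k
      have h2 := hdδ k
      have h3 := heδ k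
      rw [hδ0, NNReal.coe_zero] at h2 h3
      linarith [hle k, hd0 k, he0 k]
    rw [hSρ, hSσ]
    simp_rw [h1]
    exact le_self_add
  have hδr : (0 : ℝ) < δ := by exact_mod_cast hδ0
  have hδ1 : (δ : ℝ) ≤ 1 := hasSum_le hdl hdS hlS
  have hlog : 0 ≤ Real.log (1 + δ) := Real.log_nonneg (by linarith)
  have hηδ : 0 ≤ Real.negMulLog δ := Real.negMulLog_nonneg hδr.le hδ1
  let q : ℕ → ℝ := fun k => d k / δ
  have hq0 : ∀ k, 0 ≤ q k := fun k => div_nonneg (hd0 k) hδr.le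
  have hqS : HasSum q 1 := by
    have := hdS.div_const (δ : ℝ)
    rwa [div_self hδr.ne'] at this
  have hqsum : ∑' k, ENNReal.ofReal (q k) = 1 := by rw [hqS.tsum_ofReal hq0, ENNReal.ofReal_one]
  have hq1 := le_one_of_tsum_ofReal_eq_one hqsum
  have hd0' : ∀ i, 0 ≤ Sum.elim d (fun _ : κ₁ => 0) i := by rintro (k | j) <;> simp [hd0]
  have hdsum' : ∑' i, ENNReal.ofReal (Sum.elim d (fun _ : κ₁ => 0) i) = δ := by
    rw [ENNReal.tsum_sum_type]
    simp only [Sum.elim_inl, Sum.elim_inr, ENNReal.ofReal_zero, tsum_zero, add_zero]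
    rw [hdS.tsum_ofReal hd0, ENNReal.ofReal_coe_nnreal]
  -- Diagonal in the eigenbasis of ρ, so that `D`, ρ and the cut-off of ρ can be compared entrywise.
  obtain ⟨D, hD⟩ := exists_isDiagonal b (hasSum_of_tsum_ofReal_eq hd0' hdsum').summable
  have hDp := hD.isPositive hd0'
  have hτ : IsDiagonal b (Sum.elim q fun _ => 0) ((δ : ℝ)⁻¹ • D) := by
    intro i
    rw [smul_apply, hD i, ← Complex.coe_smul, smul_smul, ← Complex.ofReal_mul]
    rcases i with k | j
    · simp only [Sum.elim_inl, q, div_eq_inv_mul]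
    · simp
  have hq0' : ∀ i, 0 ≤ Sum.elim q (fun _ : κ₁ => 0) i := by rintro (k | j) <;> simp [hq0]
  have hq1' : ∀ i, Sum.elim q (fun _ : κ₁ => 0) i ≤ 1 := by rintro (k | j) <;> simp [hq1]
  have hτs : IsState ((δ : ℝ)⁻¹ • D) :=
    ⟨hτ.isPositive hq0', by rw [hτ.posTrace_elim hq0, hqsum]⟩
  have hSτ : vonNeumannEntropy ((δ : ℝ)⁻¹ • D) =
      ∑' k, ENNReal.ofReal (Real.negMulLog (q k)) := by
    rw [hτ.vonNeumannEntropy_eq hq0' hq1', ENNReal.tsum_sum_type]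
    simp
  have hEcut : H.energy (cutOff ρ ε) ≤ E := (h.energy_cutOff_le hρ ε.coe_nonneg).trans hE
  -- `D` plus the cut-off is dominated by ρ, since d ≤ λ and d ≤ δ ≤ ε; the cut-off energy is
  -- finite, so it may be subtracted.
  have hED : H.energy D ≤ E - H.energy (cutOff ρ ε) := by
    refine ENNReal.le_sub_of_add_le_right (ne_top_of_le_ne_top ENNReal.coe_ne_top hEcut) ?_
    rw [← h.energy_add hDp (cutOff_nonneg ρ ε)]
    refine (h.energy_mono (hDp.add (cutOff_nonneg ρ ε)) ?_).trans hE
    refine (hb.sub (hD.add (hb.cutOff ε))).isPositive ?_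
    rintro (k | j)
    · simp only [Sum.elim_inl]
      have h1 := hdl k
      have h2 := hdδ k
      have h3 : (δ : ℝ) ≤ ε := by exact_mod_cast hδε
      rcases max_cases (lam k - (ε : ℝ)) 0 with h4 | h4 <;> linarith
    · simp
  have hEτ : H.energy ((δ : ℝ)⁻¹ • D) ≤ (E - H.energy (cutOff ρ ε)) / δ := by
    rw [h.energy_smul hDp (by positivity), ENNReal.ofReal_inv_of_pos hδr,
      ENNReal.ofReal_coe_nnreal, mul_comm, ← div_eq_mul_inv]
    gcongr
  have hscale := h.mul_entropy_le_mul_maxEntropy hen hδ0 hδε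
    (X := E - H.energy (cutOff ρ ε)) (ENNReal.sub_ne_top ENNReal.coe_ne_top) hτs hEτ
  have hpt : ∀ k, ENNReal.ofReal (Real.negMulLog (lam k)) ≤
      ENNReal.ofReal (Real.negMulLog (mu k)) + δ * ENNReal.ofReal (Real.negMulLog (q k)) +
        ENNReal.ofReal (Real.negMulLog δ) * ENNReal.ofReal (q k) +
        ENNReal.ofReal (Real.log (1 + δ)) * ENNReal.ofReal (lam k + e k) := by
    intro k
    have h1 := Real.negMulLog_nonneg (hm0 k) (hm1 k)
    have h2 := Real.negMulLog_nonneg (hq0 k) (hq1 k)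
    have h3 := hq0 k
    have h4 := add_nonneg (hl0 k) (he0 k)
    rw [← ENNReal.ofReal_coe_nnreal, ← ENNReal.ofReal_mul hδr.le, ← ENNReal.ofReal_mul hηδ,
      ← ENNReal.ofReal_mul hlog, ← ENNReal.ofReal_add h1 (by positivity),
      ← ENNReal.ofReal_add (by positivity) (by positivity),
      ← ENNReal.ofReal_add (by positivity) (by positivity)]
    refine ENNReal.ofReal_le_ofReal ?_
    have h5 := negMulLog_le_of_add_eq_add (hl0 k) (hm0 k) (hd0 k) (he0 k) hδr (heδ k) (hle k)
    simp only [q]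
    linarith
  calc vonNeumannEntropy ρ
      ≤ vonNeumannEntropy σ + δ * vonNeumannEntropy ((δ : ℝ)⁻¹ • D) +
        ENNReal.ofReal (Real.negMulLog δ) +
          ENNReal.ofReal (Real.log (1 + δ)) * ENNReal.ofReal (1 + δ) := by
        rw [hSρ, hSσ, hSτ]
        refine (ENNReal.tsum_le_tsum hpt).trans_eq ?_
        rw [ENNReal.tsum_add, ENNReal.tsum_add, ENNReal.tsum_add, ENNReal.tsum_mul_left,
          ENNReal.tsum_mul_left, ENNReal.tsum_mul_left, hqsum, mul_one,
          (hlS.add heS).tsum_ofReal fun k => add_nonneg (hl0 k) (he0 k)]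
    _ = vonNeumannEntropy σ + (δ * vonNeumannEntropy ((δ : ℝ)⁻¹ • D) +
        ENNReal.ofReal (gFun δ)) := by
        rw [gFun_eq, ENNReal.ofReal_add hηδ (by positivity), ← ENNReal.ofReal_mul hlog,
          mul_comm (1 + (δ : ℝ))]
        simp only [add_assoc]
    _ ≤ _ := by
        gcongr
        exact gFun_mono hδr (by exact_mod_cast hδε)

/-- The semicontinuity bound is close to optimal. -/
theorem exists_states_close_to_optimal (h : H.IsEigenbasis en t) (hen : en 0 = 0)
    (hG : H.GibbsCondition) {E ε : ℝ≥0} (hE : 0 < E) (hε : 0 < ε) (hε1 : ε ≤ 1) :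
    ∃ ρ σ : 𝓗 →L[ℂ] 𝓗, IsState ρ ∧ IsState σ ∧ H.energy ρ ≤ E ∧ traceNorm (ρ - σ) / 2 ≤ ε ∧
      vonNeumannEntropy σ + ε * H.maxEntropy (E / ε) ≤ vonNeumannEntropy ρ ∧
      (ε < 1 → vonNeumannEntropy σ + ε * H.maxEntropy (E / ε) < vonNeumannEntropy ρ) := by
  have hEε : (E : ℝ≥0∞) / ε = ((E / ε : ℝ≥0) : ℝ≥0∞) := (ENNReal.coe_div hε.ne').symm
  obtain ⟨p, hp, hp1, hpE, hmax⟩ := h.exists_maximizer hen hG (X := E / ε) (div_pos hE hε)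
  have hp0 : ∀ k, 0 ≤ p k := fun k => (hp k).le
  let g : ℕ → ℝ := fun k => if k = 0 then 1 else 0
  have hg0 : ∀ k, 0 ≤ g k := fun k => by simp only [g]; split_ifs <;> norm_num
  have hg : ∀ k, ENNReal.ofReal (g k) = if k = 0 then 1 else 0 := fun k => by
    simp only [g]; split_ifs <;> simp
  have hg1 : ∑' k, ENNReal.ofReal (g k) = 1 := by
    simp_rw [hg]
    exact tsum_ite_eq 0 _
  obtain ⟨ρ, hρd, hρ, hρE, hρS⟩ :=
    h.exists_state (mixZero_nonneg hε1 hp0) (tsum_mixZero hε1 hp0 hp1)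
  obtain ⟨σ, hσd, hσ, -, hσS⟩ := h.exists_state hg0 hg1
  have hσS0 : vonNeumannEntropy σ = 0 := by
    rw [hσS, ENNReal.tsum_eq_zero]
    intro k
    simp only [g]
    split_ifs <;> simp
  have hEρ : H.energy ρ ≤ E := by
    rw [hρE, tsum_mul_mixZero hε1 hp0 hen]
    calc (ε : ℝ≥0∞) * _ ≤ ε * ((E / ε : ℝ≥0) : ℝ≥0∞) := by gcongr
      _ = E := by rw [← ENNReal.coe_mul, mul_div_cancel₀ _ hε.ne']
  have hmaxtop : H.maxEntropy ((E / ε : ℝ≥0) : ℝ≥0∞) < ∞ :=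
    h.maxEntropy_lt_top hG ENNReal.coe_ne_top
  have hle : (ε : ℝ≥0∞) * H.maxEntropy ((E / ε : ℝ≥0) : ℝ≥0∞) ≤
      ∑' k, ε * ENNReal.ofReal (Real.negMulLog (p k)) := by
    rw [ENNReal.tsum_mul_left]
    gcongr
  have hSρtop : vonNeumannEntropy ρ ≠ ∞ := by
    refine ne_top_of_le_ne_top (h.maxEntropy_lt_top hG (X := E) ENNReal.coe_ne_top).ne ?_
    exact le_iSup_of_le ⟨ρ, hρ, hEρ⟩ le_rfl
  rw [hEε]
  refine ⟨ρ, σ, hρ, hσ, hEρ, ?_, ?_, fun hlt => ?_⟩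
  · have hd : IsDiagonal t (fun i => |Sum.elim (mixZero ε p) (fun _ => 0) i -
        Sum.elim g (fun _ => 0) i|) (CFC.abs (ρ - σ)) := (hρd.sub hσd).abs
    rw [traceNorm, hd.posTrace_eq fun _ => abs_nonneg _, ENNReal.tsum_sum_type]
    simp only [Sum.elim_inl, Sum.elim_inr, sub_self, abs_zero, ENNReal.ofReal_zero, tsum_zero,
      add_zero]
    refine ENNReal.div_le_of_le_mul ?_
    calc ∑' k, ENNReal.ofReal |mixZero ε p k - g k|
        ≤ ∑' k, ε * (ENNReal.ofReal (p k) + ENNReal.ofReal (g k)) := by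
          refine ENNReal.tsum_le_tsum fun k => ?_
          rw [← ENNReal.ofReal_add (hp0 k) (hg0 k), ← ENNReal.ofReal_coe_nnreal,
            ← ENNReal.ofReal_mul ε.coe_nonneg]
          refine ENNReal.ofReal_le_ofReal ?_
          have h1 : mixZero ε p k - g k = ε * (p k - g k) := by
            simp only [mixZero, g]; ring
          rw [h1, abs_mul, abs_of_nonneg ε.coe_nonneg]
          refine mul_le_mul_of_nonneg_left ?_ ε.coe_nonneg
          refine (abs_sub _ _).trans ?_
          rw [abs_of_nonneg (hp0 k), abs_of_nonneg (hg0 k)]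
      _ = ε * 2 := by
          rw [ENNReal.tsum_mul_left, ENNReal.tsum_add, hp1, hg1, one_add_one_eq_two]
  · rw [hσS0, zero_add, hρS]
    exact hle.trans (ENNReal.tsum_le_tsum (mul_negMulLog_le_mixZero hε1 hp0))
  · rw [hσS0, zero_add, hρS]
    have hle' := ENNReal.tsum_le_tsum (mul_negMulLog_le_mixZero hε1 hp0)
    refine hle.trans_lt (ENNReal.tsum_lt_tsum (i := 1) ?_
      (mul_negMulLog_le_mixZero hε1 hp0) ?_)
    · exact ne_top_of_le_ne_top hSρtop (hρS ▸ hle')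
    -- At level 1 the point mass contributes nothing, so η(εp₁) = εη(p₁) + p₁η(ε), and the gain
    -- p₁η(ε) is positive for ε < 1.
    · have h1 : mixZero ε p 1 = ε * p 1 := by simp [mixZero]
      have hεr : (0 : ℝ) < ε := by exact_mod_cast hε
      have h2 : 0 < Real.negMulLog ε := by
        have := Real.log_neg hεr (by exact_mod_cast hlt)
        rw [Real.negMulLog]
        nlinarith
      rw [h1, Real.negMulLog_mul, ← ENNReal.ofReal_coe_nnreal, ← ENNReal.ofReal_mul hεr.le]
      have h3 : 0 < p 1 * Real.negMulLog ε := mul_pos (hp 1) h2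
      have h4 : 0 ≤ (ε : ℝ) * Real.negMulLog (p 1) :=
        mul_nonneg hεr.le (Real.negMulLog_nonneg (hp0 1) (le_one_of_tsum_ofReal_eq_one hp1 1))
      rw [ENNReal.ofReal_lt_ofReal_iff (by linarith)]
      linarith

end PositiveOperator.IsEigenbasis

theorem PositiveOperator.maxEntropy_mono {𝓗 : Type*} [NormedAddCommGroup 𝓗]
    [InnerProductSpace ℂ 𝓗] [CompleteSpace 𝓗] (H : PositiveOperator 𝓗) : Monotone H.maxEntropy :=
  fun _ _ hXY => iSup_le fun ρ => le_iSup_of_le ⟨ρ.1, ρ.2.1, ρ.2.2.trans hXY⟩ le_rfl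

end

theorem proposition1 {𝓗 : Type*} [NormedAddCommGroup 𝓗] [InnerProductSpace ℂ 𝓗]
    [CompleteSpace 𝓗] [TopologicalSpace.SeparableSpace 𝓗]
    (H : PositiveOperator 𝓗) (hdim : ¬ FiniteDimensional ℂ H.op.domain)
    (hGibbs : H.GibbsCondition) (hzero : H.ZeroGroundEnergy) :
    -- the continuity bounds
    (∀ (E ε : ℝ≥0) (ρ : 𝓗 →L[ℂ] 𝓗), 0 < ε → IsState ρ → H.energy ρ ≤ E →
      -- all quantities below (except possibly `S(σ)`) are finite, `E - E_{H,ε}(ρ)` is nonnegative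
      vonNeumannEntropy ρ < ∞ ∧ H.maxEntropy (E / ε) < ∞ ∧ H.energy (cutOff ρ ε) ≤ E ∧
      -- the first bound
      (∀ σ : 𝓗 →L[ℂ] 𝓗, IsState σ → traceNorm (ρ - σ) / 2 ≤ ε →
        vonNeumannEntropy ρ ≤ vonNeumannEntropy σ +
          (ε * H.maxEntropy ((E - H.energy (cutOff ρ ε)) / ε) + ENNReal.ofReal (gFun ε))) ∧
      ε * H.maxEntropy ((E - H.energy (cutOff ρ ε)) / ε) + ENNReal.ofReal (gFun ε) ≤
        ε * H.maxEntropy (E / ε) + ENNReal.ofReal (gFun ε) ∧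
      -- the bound with `E_{H,ε}(ρ)` replaced by its lower bound `E*_{H,ε}(ρ)`, where `en` and `lam`
      -- are the eigenvalue sequences of `H` and of `ρ` (which exist)
      (∃ en : ℕ → ℝ, H.IsIncreasingEigenvalueSeq en) ∧
      (∃ lam : ℕ → ℝ, IsDecreasingEigenvalueSeq ρ lam) ∧
      (∀ en lam : ℕ → ℝ, H.IsIncreasingEigenvalueSeq en → IsDecreasingEigenvalueSeq ρ lam →
        lowerCutOffEnergy en lam ε ≤ H.energy (cutOff ρ ε) ∧
        (∀ σ : 𝓗 →L[ℂ] 𝓗, IsState σ → traceNorm (ρ - σ) / 2 ≤ ε →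
          vonNeumannEntropy ρ ≤ vonNeumannEntropy σ +
            (ε * H.maxEntropy ((E - lowerCutOffEnergy en lam ε) / ε) +
              ENNReal.ofReal (gFun ε))) ∧
        ε * H.maxEntropy ((E - lowerCutOffEnergy en lam ε) / ε) + ENNReal.ofReal (gFun ε) ≤
          ε * H.maxEntropy (E / ε) + ENNReal.ofReal (gFun ε))) ∧
    -- the bound is close to optimal
    (∀ E ε : ℝ≥0, 0 < E → 0 < ε → ε ≤ 1 →
      ∃ ρ σ : 𝓗 →L[ℂ] 𝓗, IsState ρ ∧ IsState σ ∧ H.energy ρ ≤ E ∧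
        traceNorm (ρ - σ) / 2 ≤ ε ∧
        vonNeumannEntropy σ + ε * H.maxEntropy (E / ε) ≤ vonNeumannEntropy ρ ∧
        (ε < 1 → vonNeumannEntropy σ + ε * H.maxEntropy (E / ε) < vonNeumannEntropy ρ)) := by

  obtain ⟨en₀, hen₀⟩ := PositiveOperator.exists_isIncreasingEigenvalueSeq hdim hGibbs
  obtain ⟨κ, t, h, -, -⟩ := hen₀.exists_isEigenbasis
  have h0 := hen₀.zero_eq_zero hzero
  have hinf : ¬ FiniteDimensional ℂ 𝓗 := fun _ => hdim inferInstance
  refine ⟨fun E ε ρ hε hρ hE => ?_, fun E ε hE hε hε1 =>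
    h.exists_states_close_to_optimal h0 hGibbs hE hε hε1⟩
  obtain ⟨lam₀, hlam₀⟩ := exists_isDecreasingEigenvalueSeq hinf hρ.1
    (by rw [hρ.2]; exact ENNReal.one_ne_top)
  have hbound := fun (σ : 𝓗 →L[ℂ] 𝓗) (hσ : IsState σ) (hρσ : traceNorm (ρ - σ) / 2 ≤ ε) =>
    h.entropy_le_entropy_add h0 hρ hE hσ hρσ hlam₀
  have hmono : ∀ X Y : ℝ≥0∞, X ≤ Y →
      ε * H.maxEntropy (X / ε) + ENNReal.ofReal (gFun ε) ≤
        ε * H.maxEntropy (Y / ε) + ENNReal.ofReal (gFun ε) := fun X Y hXY => by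
    gcongr
    exact H.maxEntropy_mono (ENNReal.div_le_div_right hXY _)
  refine ⟨?_, h.maxEntropy_lt_top hGibbs (ENNReal.div_ne_top ENNReal.coe_ne_top
    (by exact_mod_cast hε.ne')), (h.energy_cutOff_le hρ ε.coe_nonneg).trans hE, hbound,
    hmono _ _ tsub_le_self, ⟨en₀, hen₀⟩, ⟨lam₀, hlam₀⟩, fun en lam hen hlam => ?_⟩
  · exact lt_of_le_of_lt (le_iSup_of_le ⟨ρ, hρ, hE⟩ le_rfl)
      (h.maxEntropy_lt_top hGibbs (X := E) ENNReal.coe_ne_top)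
  -- The sequences `en` and `lam` are arbitrary here and get their own bases; the entropy bound
  -- already holds, and monotonicity of F_H transfers it.
  have hlow : lowerCutOffEnergy en lam ε ≤ H.energy (cutOff ρ ε) := by
    obtain ⟨κ', t', h', -, -⟩ := hen.exists_isEigenbasis
    obtain ⟨κ'', b, hb⟩ := hlam.exists_isDiagonal
    refine h'.tsum_mul_eigenvalue_le_energy hen.1 (b := b) (fun i => ?_)
      (fun k => le_max_right _ _) fun m n hmn => max_le_max (sub_le_sub_right (hlam.1 hmn) _) le_rfl
    rw [hb.cutOff ε i]
    rcases i with k | j <;> simp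
  exact ⟨hlow, fun σ hσ hρσ => (hbound σ hσ hρσ).trans
    (add_le_add_right (hmono _ _ (tsub_le_tsub_left hlow _)) _), hmono _ _ tsub_le_self⟩
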